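/- Let $1<p<\infty$, $0<\underline E\le\overline E<\infty$, $\underline\Sigma>0$, $\overline L<\infty$, and let $\chi_4:(0,\infty)\to[0,\infty)$ satisfy $\chi_4(r)\to0$ as $r\to0^+$. For a probability density $f$ on $\mathbb R$ put $$E=\int_{\mathbb R} v^2f(v)\,dv,\qquad \Sigma=\Bigl(\int_{\mathbb R}(v^2-E)^2f(v)\,dv\Bigr)^{1/2},\qquad Z_N(f,r)=\int_{S^{N-1}(r)}f^{\otimes N}\,d\sigma^N_r,$$ where $f^{\otimes N}(v)=\prod_{j=1}^N f(v_j)$ and $\sigma^N_r$ is the uniform probability measure on the sphere $S^{N-1}(r)$ of radius $r>0$ centred at $0$ in $\mathbb R^N$. Put also $$\gamma^{(N)}(r)=\frac{e^{-r^2/2}}{(2\pi)^{N/2}},\qquad \alpha_N(s)=s^{\frac N2-1}e^{-\frac s2}\quad(s>0).$$ Then there are a function $\omega:\mathbb N\to\mathbb R$ with $\omega(N)\to0$ as $N\to\infty$ and an integer $N_0$, both depending only on $\underline E,\overline E,\underline\Sigma,p,\overline L$ and $\chi_4$, such that the following holds for every probability density $f$ on $\mathbb R$ with finite fourth moment and $f\in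 L^p(\mathbb R)$ satisfying $$\underline E\le E\le\overline E,\qquad \Sigma\ge\underline\Sigma,\qquad \|f\|_{L^p}\le\overline L,\qquad \int_{|v|\ge 1/r}f(v)\,v^4\,dv\le\chi_4(r)\quad\text{for all } r>0,$$ and for every $N\ge N_0$. For every $r>0$, $f^{\otimes N}$ is $\sigma^N_r$-integrable, $Z_N(f,r)$ is unchanged if $f$ is modified on a Lebesgue-null subset of $\mathbb R$, and $$Z_N(f,r)=\frac{\sqrt2}{\Sigma}\,\gamma^{(N)}(r)\,\frac{\alpha_N(N)}{\alpha_N(r^2)}\Bigl[e^{-\frac{(r^2-NE)^2}{2N\Sigma^2}}+\varepsilon\Bigr]\quad\text{for some }\varepsilon=\varepsilon(N,f,r)\text{ with }|\varepsilon|\le\omega(N).$$ In particular, $$Z_N(f,\sqrt N)=\frac{\sqrt2}{\Sigma}\,\gamma^{(N)}(\sqrt N)\Bigl[e^{-\frac{N(1-E)^2}{2\Sigma^2}}+\varepsilon'\Bigr]\quad\text{for some }\varepsilon'=\varepsilon'(N,f)\text{ with }|\varepsilon'|\le\omega(N).$$ -/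

import Mathlib

open MeasureTheory Filter Topology

noncomputable section

namespace CondTensor

/-- The function `f` on the real line is a probability density with respect to Lebesgue measure
(as an almost everywhere defined function). -/
structure IsProbDensity (f : ℝ → ℝ) : Prop where
  nonneg : ∀ᵐ v, 0 ≤ f v
  integrable : Integrable f
  integral_eq_one : ∫ v, f v = 1

/-- The mean kinetic energy `E = ∫ f(v) v² dv`. -/
def energy (f : ℝ → ℝ) : ℝ := ∫ v, f v * v ^ 2

/-- The standard deviation `Σ = (∫ (v² - E)² f(v) dv)^{1/2}` of the kinetic energy. -/
def energyDev (f : ℝ → ℝ) : ℝ := Real.sqrt (∫ v, (v ^ 2 - energy f) ^ 2 * f v)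

/-- The uniform probability measure on the unit sphere of `ℝ^N`: the normalized surface measure
(a probability measure as soon as `N ≥ 1`). -/
def unitSphereUnif (N : ℕ) : Measure (Metric.sphere (0 : EuclideanSpace ℝ (Fin N)) 1) :=
  ((volume : Measure (EuclideanSpace ℝ (Fin N))).toSphere Set.univ)⁻¹ •
    (volume : Measure (EuclideanSpace ℝ (Fin N))).toSphere

/-- The uniform probability measure `σ^N_r` on the sphere `S^{N-1}(r)` of radius `r > 0` in `ℝ^N`,
as a measure on `ℝ^N` carried by that sphere: the image of the uniform probability measure on the
unit sphere under the dilation `y ↦ r y`. -/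
def sphereUnif (N : ℕ) (r : ℝ) : Measure (EuclideanSpace ℝ (Fin N)) :=
  (unitSphereUnif N).map
    fun y : Metric.sphere (0 : EuclideanSpace ℝ (Fin N)) 1 => r • (y : EuclideanSpace ℝ (Fin N))

/-- The tensor power `f^{⊗N}(v) = f(v_1) ⋯ f(v_N)`. -/
def tensorPow (f : ℝ → ℝ) (N : ℕ) (v : EuclideanSpace ℝ (Fin N)) : ℝ := ∏ i, f (v i)

/-- `Z_N(f, r) = ∫_{S^{N-1}(r)} f^{⊗N} dσ^N_r`. -/
def Z (N : ℕ) (f : ℝ → ℝ) (r : ℝ) : ℝ := ∫ v, tensorPow f N v ∂(sphereUnif N r)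

/-- `γ^{(N)}(r) = e^{-r²/2} / (2π)^{N/2}`, the constant value on `S^{N-1}(r)` of the standard
Gaussian density of `ℝ^N`. -/
def gaussRadial (N : ℕ) (r : ℝ) : ℝ :=
  Real.exp (-r ^ 2 / 2) / (2 * Real.pi) ^ ((N : ℝ) / 2)

/-- `α_N(s) = s^{N/2 - 1} e^{-s/2}`. -/
def alpha (N : ℕ) (s : ℝ) : ℝ := s ^ ((N : ℝ) / 2 - 1) * Real.exp (-s / 2)

end CondTensor

end

/-!
Under `f^{⊗N}` the energy `∑ v_j ^ 2` has a density at `s`, which is `Z_N(f, √s)` times the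
density of Lebesgue measure of `ℝ^N` along the energy shells. The theorem is therefore a local
central limit theorem for that density, uniform in `f`.

Projecting out any two coordinates sends the measure of an energy shell to a measure with density
at most `π`. A Hölder inequality over the `N` coordinates then bounds the density of the energy by
`π ‖f‖_q ^ N` with `q = N / (N - 2)`; as `q → 1`, it is bounded and continuous for all large `N`.
By Plancherel a fixed power of the characteristic function of `v ^ 2` is integrable, with a bound
uniform in `f`. Together with a uniform Taylor expansion at `0` and a uniform Cramér condition away
from `0`, both consequences of the equi-integrability of the fourth moments, this gives the local
limit theorem by Fourier inversion.

The area of the sphere is eliminated without Stirling's formula by comparing with the standard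
Gaussian density, for which `Z_N` is exactly `γ^{(N)}` and to which the same theorem applies.
-/

noncomputable section

namespace CondTensor

open scoped ENNReal

section Products

theorem prod_prod_compl_pair {ι M : Type*} [Fintype ι] [DecidableEq ι] [CommMonoid M]
    {σ : Equiv.Perm ι} (hσ : ∀ i, σ i ≠ i) (x : ι → M) :
    ∏ i, ∏ j ∈ ({i, σ i} : Finset ι)ᶜ, x j = ∏ j, x j ^ (Fintype.card ι - 2) := by
  rw [Finset.prod_comm' (t' := Finset.univ) (s' := fun j => ({j, σ.symm j} : Finset ι)ᶜ)]
  · refine Finset.prod_congr rfl fun j _ => ?_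
    have hj : j ≠ σ.symm j := fun h => hσ j ((Equiv.eq_symm_apply σ).1 h)
    rw [Finset.prod_const, Finset.card_compl, Finset.card_pair hj]
  · intro i j
    simp only [Finset.mem_univ, Finset.mem_compl, Finset.mem_insert, Finset.mem_singleton, true_and,
      and_true, not_or, Equiv.eq_symm_apply]
    exact ⟨fun h => ⟨fun e => h.1 e.symm, fun e => h.2 e.symm⟩,
      fun h => ⟨fun e => h.1 e.symm, fun e => h.2 e.symm⟩⟩

theorem lintegral_prod_le_of_compl_pair {ι α : Type*} [Fintype ι] [DecidableEq ι]
    [MeasurableSpace α] {μ : Measure α} (hcard : 3 ≤ Fintype.card ι)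
    {σ : Equiv.Perm ι} (hσ : ∀ i, σ i ≠ i) {G : ι → α → ℝ≥0∞} (hG : ∀ i, AEMeasurable (G i) μ)
    {C : ℝ≥0∞} {K : ι → ℝ≥0∞} {q : ℝ} (hq : q = Fintype.card ι / (Fintype.card ι - 2))
    (h : ∀ i, ∫⁻ a, ∏ j ∈ ({i, σ i} : Finset ι)ᶜ, G j a ^ q ∂μ
      ≤ C * ∏ j ∈ ({i, σ i} : Finset ι)ᶜ, K j) :
    ∫⁻ a, ∏ j, G j a ∂μ ≤ C * ∏ j, K j ^ (1 / q) := by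
  set n := Fintype.card ι with hn
  have hn3 : (3 : ℝ) ≤ n := by exact_mod_cast hcard
  have hn0 : (n : ℝ) ≠ 0 := by positivity
  have hn2 : (n : ℝ) - 2 ≠ 0 := by linarith
  have hcast : ((n - 2 : ℕ) : ℝ) = n - 2 := by
    rw [Nat.cast_sub (by omega), Nat.cast_ofNat]
  have hq0 : q ≠ 0 := by rw [hq]; positivity
  have geomMean : ∀ x : ι → ℝ≥0∞, ∏ i, (∏ j ∈ ({i, σ i} : Finset ι)ᶜ, x j) ^ (1 / (n : ℝ))
      = ∏ j, x j ^ (1 / q) := by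
    intro x
    rw [ENNReal.prod_rpow_of_nonneg (by positivity), prod_prod_compl_pair hσ,
      ← ENNReal.prod_rpow_of_nonneg (by positivity)]
    refine Finset.prod_congr rfl fun j _ => ?_
    rw [← ENNReal.rpow_natCast, ← ENNReal.rpow_mul, hcast, hq]
    congr 1
    field_simp
  calc ∫⁻ a, ∏ j, G j a ∂μ
      = ∫⁻ a, ∏ i, (∏ j ∈ ({i, σ i} : Finset ι)ᶜ, G j a ^ q) ^ (1 / (n : ℝ)) ∂μ := by
        refine lintegral_congr fun a => ?_
        rw [geomMean]
        simp_rw [← ENNReal.rpow_mul, mul_one_div_cancel hq0, ENNReal.rpow_one]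
    _ ≤ ∏ i, (∫⁻ a, ∏ j ∈ ({i, σ i} : Finset ι)ᶜ, G j a ^ q ∂μ) ^ (1 / (n : ℝ)) := by
        refine ENNReal.lintegral_prod_norm_pow_le Finset.univ
          (fun i _ => Finset.aemeasurable_fun_prod _ fun j _ => (hG j).pow_const _) ?_
          (fun _ _ => by positivity)
        rw [Finset.sum_const, Finset.card_univ, ← hn, nsmul_eq_mul, mul_one_div_cancel hn0]
    _ ≤ ∏ i, (C * ∏ j ∈ ({i, σ i} : Finset ι)ᶜ, K j) ^ (1 / (n : ℝ)) := by
        gcongr with i _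
        exact h i
    _ = C * ∏ j, K j ^ (1 / q) := by
        simp_rw [ENNReal.mul_rpow_of_nonneg _ _ (show 0 ≤ 1 / (n : ℝ) by positivity)]
        rw [Finset.prod_mul_distrib, geomMean, Finset.prod_const, Finset.card_univ, ← hn,
          ← ENNReal.rpow_natCast, ← ENNReal.rpow_mul, one_div_mul_cancel hn0, ENNReal.rpow_one]

variable {ι : Type*} {X : ι → Type*} [∀ i, MeasurableSpace (X i)]
  {μ : ∀ i, Measure (X i)} [∀ i, SigmaFinite (μ i)] {F : ∀ i, X i → ℝ≥0∞}

theorem lmarginal_prod_eq_prod_lintegral [DecidableEq ι] (hF : ∀ i, Measurable (F i))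
    (s : Finset ι) :
    ∫⋯∫⁻_s, (fun x => ∏ j ∈ s, F j (x j)) ∂μ = fun _ => ∏ j ∈ s, ∫⁻ u, F j u ∂μ j := by
  have hmeas : ∀ t : Finset ι, Measurable fun x : ∀ i, X i => ∏ j ∈ t, F j (x j) := fun t =>
    Finset.measurable_fun_prod _ fun j _ => (hF j).comp (measurable_pi_apply j)
  induction s using Finset.induction_on with
  | empty => simp
  | insert i s hi ih =>
    have integrate_i : ∀ x : ∀ i, X i,
        ∫⁻ u, ∏ j ∈ insert i s, F j (Function.update x i u j) ∂μ i
          = (∫⁻ u, F i u ∂μ i) * ∏ j ∈ s, F j (x j) := by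
      intro x
      rw [← lintegral_mul_const _ (hF i)]
      refine lintegral_congr fun u => ?_
      rw [Finset.prod_insert hi, Function.update_self]
      congr 1
      exact Finset.prod_congr rfl fun j hj => by
        rw [Function.update_of_ne (ne_of_mem_of_not_mem hj hi)]
    rw [lmarginal_insert' _ (hmeas _) hi]
    simp_rw [integrate_i]
    funext x
    have ihx := congrFun ih x
    simp only [lmarginal] at ihx ⊢
    rw [lintegral_const_mul, ihx, Finset.prod_insert hi]
    exact (hmeas s).comp measurable_updateFinset

theorem lintegral_pi_prod_eq_prod [Fintype ι] (hF : ∀ i, Measurable (F i)) :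
    ∫⁻ x, ∏ j, F j (x j) ∂Measure.pi μ = ∏ j, ∫⁻ u, F j u ∂μ j := by
  classical
  rcases isEmpty_or_nonempty (∀ i, X i) with hX | ⟨⟨x⟩⟩
  · obtain ⟨i, hi⟩ := isEmpty_pi.1 hX
    rw [lintegral_of_isEmpty, Finset.prod_eq_zero (Finset.mem_univ i) (lintegral_of_isEmpty _ _)]
  · have := congrFun (lmarginal_prod_eq_prod_lintegral (μ := μ) hF Finset.univ) x
    rwa [lmarginal_univ] at this

end Products

section RadialWeights

theorem setLIntegral_two_mul_comp_sq (g : ℝ → ℝ≥0∞) :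
    ∫⁻ ρ in Set.Ioi (0 : ℝ), ENNReal.ofReal (2 * ρ) * g (ρ ^ 2) = ∫⁻ s in Set.Ioi (0 : ℝ), g s := by
  have image_sq : (fun ρ : ℝ => ρ ^ 2) '' Set.Ioi 0 = Set.Ioi 0 := by
    ext s
    exact ⟨fun ⟨ρ, hρ, h⟩ => h ▸ pow_pos (Set.mem_Ioi.1 hρ) 2,
      fun hs => ⟨√s, Real.sqrt_pos.2 hs, Real.sq_sqrt (Set.mem_Ioi.1 hs).le⟩⟩
  have injOn_sq : Set.InjOn (fun ρ : ℝ => ρ ^ 2) (Set.Ioi 0) := fun a ha b hb h =>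
    (pow_left_inj₀ (Set.mem_Ioi.1 ha).le (Set.mem_Ioi.1 hb).le two_ne_zero).1 h
  have change := lintegral_image_eq_lintegral_abs_deriv_mul (f' := fun ρ => 2 * ρ)
    measurableSet_Ioi (fun ρ _ => by simpa using (hasDerivAt_pow 2 ρ).hasDerivWithinAt) injOn_sq g
  rw [image_sq] at change
  rw [change]
  refine setLIntegral_congr_fun measurableSet_Ioi fun ρ hρ => ?_
  rw [abs_of_pos (mul_pos two_pos (Set.mem_Ioi.1 hρ))]

theorem lintegral_lintegral_comp_sq_add_sq {g : ℝ → ℝ≥0∞} (hg : Measurable g) :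
    ∫⁻ x : ℝ, ∫⁻ y : ℝ, g (x ^ 2 + y ^ 2)
      = ENNReal.ofReal Real.pi * ∫⁻ s in Set.Ioi (0 : ℝ), g s := by
  have angle : ENNReal.ofReal (Real.pi - -Real.pi) = ENNReal.ofReal Real.pi * 2 := by
    rw [show Real.pi - -Real.pi = Real.pi * 2 by ring, ENNReal.ofReal_mul Real.pi_pos.le,
      ENNReal.ofReal_ofNat]
  have norm_sq : ∀ p : ℝ × ℝ,
      (polarCoord.symm p).1 ^ 2 + (polarCoord.symm p).2 ^ 2 = p.1 ^ 2 := by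
    intro p
    simp only [polarCoord_symm_apply]
    linear_combination p.1 ^ 2 * Real.sin_sq_add_cos_sq p.2
  calc ∫⁻ x : ℝ, ∫⁻ y : ℝ, g (x ^ 2 + y ^ 2)
      = ∫⁻ p : ℝ × ℝ, g (p.1 ^ 2 + p.2 ^ 2) := by
        rw [Measure.volume_eq_prod, lintegral_prod _ (by fun_prop)]
    _ = ∫⁻ ρ in Set.Ioi (0 : ℝ), ENNReal.ofReal ρ * g (ρ ^ 2) *
          ENNReal.ofReal (Real.pi - -Real.pi) := by
        rw [← lintegral_comp_polarCoord_symm]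
        simp_rw [norm_sq, polarCoord_target, smul_eq_mul]
        rw [Measure.volume_eq_prod, ← Measure.prod_restrict, lintegral_prod _ (by fun_prop)]
        simp only [lintegral_const, Measure.restrict_apply MeasurableSet.univ, Set.univ_inter,
          Real.volume_Ioo]
    _ = ENNReal.ofReal Real.pi * ∫⁻ ρ in Set.Ioi (0 : ℝ), ENNReal.ofReal (2 * ρ) * g (ρ ^ 2) := by
        rw [← lintegral_const_mul _ (by fun_prop)]
        refine lintegral_congr fun ρ => ?_
        rw [angle, ENNReal.ofReal_mul two_pos.le, ENNReal.ofReal_ofNat]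
        ring
    _ = _ := by rw [setLIntegral_two_mul_comp_sq]

theorem lintegral_lintegral_comp_sq_add_sq_add_le {g : ℝ → ℝ≥0∞} (hg : Measurable g) (c : ℝ) :
    ∫⁻ x : ℝ, ∫⁻ y : ℝ, g (x ^ 2 + y ^ 2 + c) ≤ ENNReal.ofReal Real.pi * ∫⁻ u, g u := by
  rw [lintegral_lintegral_comp_sq_add_sq (g := fun u => g (u + c)) (by fun_prop)]
  refine mul_le_mul' le_rfl ?_
  exact (setLIntegral_le_lintegral _ _).trans_eq (lintegral_add_right_eq_self (μ := volume) g c)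

variable {ι : Type*} [Fintype ι] [DecidableEq ι] {i k : ι}

theorem lmarginal_pair_comp_sum_sq_mul_le (hik : i ≠ k) {g : ℝ → ℝ≥0∞} (hg : Measurable g)
    {H : (({i, k}ᶜ : Finset ι) → ℝ) → ℝ≥0∞} (hH : Measurable H) :
    ∫⋯∫⁻_{i, k}, (fun x : ι → ℝ => g (∑ j, x j ^ 2) * H (({i, k}ᶜ : Finset ι).restrict x))
        ∂(fun _ => volume)
      ≤ fun x => (ENNReal.ofReal Real.pi * ∫⁻ u, g u) * H (({i, k}ᶜ : Finset ι).restrict x) := by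
  intro x
  have ne_of_mem : ∀ j ∈ ({i, k}ᶜ : Finset ι), j ≠ i ∧ j ≠ k := fun j hj => by simpa using hj
  have restrict_update : ∀ a b : ℝ,
      ({i, k}ᶜ : Finset ι).restrict (Function.update (Function.update x i a) k b)
        = ({i, k}ᶜ : Finset ι).restrict x := by
    intro a b
    ext ⟨j, hj⟩
    simp [Finset.restrict, Function.update_of_ne (ne_of_mem j hj).1,
      Function.update_of_ne (ne_of_mem j hj).2]
  have sum_sq_update : ∀ a b : ℝ, ∑ j, (Function.update (Function.update x i a) k b) j ^ 2
      = a ^ 2 + b ^ 2 + ∑ j ∈ ({i, k}ᶜ : Finset ι), x j ^ 2 := by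
    intro a b
    rw [← Finset.sum_add_sum_compl {i, k}, Finset.sum_pair hik, Function.update_of_ne hik,
      Function.update_self, Function.update_self]
    congr 1
    refine Finset.sum_congr rfl fun j hj => ?_
    rw [Function.update_of_ne (ne_of_mem j hj).2, Function.update_of_ne (ne_of_mem j hj).1]
  rw [lmarginal_insert _ (by fun_prop) (by simpa using hik)]
  simp_rw [lmarginal_singleton, restrict_update, sum_sq_update]
  have pull_out : ∀ a : ℝ, ∫⁻ b : ℝ, g (a ^ 2 + b ^ 2 + ∑ j ∈ ({i, k}ᶜ : Finset ι), x j ^ 2) *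
        H (({i, k}ᶜ : Finset ι).restrict x)
      = (∫⁻ b : ℝ, g (a ^ 2 + b ^ 2 + ∑ j ∈ ({i, k}ᶜ : Finset ι), x j ^ 2)) *
        H (({i, k}ᶜ : Finset ι).restrict x) :=
    fun a => lintegral_mul_const _ (by fun_prop)
  rw [lintegral_congr pull_out, lintegral_mul_const _ (Measurable.lintegral_prod_right'
    (f := fun p : ℝ × ℝ => g (p.1 ^ 2 + p.2 ^ 2 + ∑ j ∈ ({i, k}ᶜ : Finset ι), x j ^ 2))
    (by fun_prop))]
  gcongr
  exact lintegral_lintegral_comp_sq_add_sq_add_le hg _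

theorem lintegral_comp_sum_sq_mul_restrict_le (hik : i ≠ k) {g : ℝ → ℝ≥0∞} (hg : Measurable g)
    {H : (({i, k}ᶜ : Finset ι) → ℝ) → ℝ≥0∞} (hH : Measurable H) :
    ∫⁻ x : ι → ℝ, g (∑ j, x j ^ 2) * H (({i, k}ᶜ : Finset ι).restrict x)
      ≤ (ENNReal.ofReal Real.pi * ∫⁻ u, g u) * ∫⁻ y, H y := by
  have restrict_updateFinset : ∀ y : ({i, k}ᶜ : Finset ι) → ℝ,
      ({i, k}ᶜ : Finset ι).restrict (Function.updateFinset (0 : ι → ℝ) {i, k}ᶜ y) = y := by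
    intro y
    ext j
    simp only [Finset.restrict, Function.updateFinset, dif_pos j.2, Subtype.coe_eta]
  calc ∫⁻ x : ι → ℝ, g (∑ j, x j ^ 2) * H (({i, k}ᶜ : Finset ι).restrict x)
      = (∫⋯∫⁻_{i, k}ᶜ ∪ {i, k}, (fun x => g (∑ j, x j ^ 2) *
          H (({i, k}ᶜ : Finset ι).restrict x)) ∂(fun _ => volume)) (0 : ι → ℝ) := by
        rw [Finset.union_comm, Finset.union_compl, lmarginal_univ, volume_pi]
    _ ≤ (∫⋯∫⁻_{i, k}ᶜ, (fun x => (ENNReal.ofReal Real.pi * ∫⁻ u, g u) *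
          H (({i, k}ᶜ : Finset ι).restrict x)) ∂(fun _ => volume)) (0 : ι → ℝ) := by
        rw [lmarginal_union _ _ (by fun_prop) disjoint_compl_left]
        exact lmarginal_mono (lmarginal_pair_comp_sum_sq_mul_le hik hg hH) _
    _ = _ := by
        simp only [lmarginal, restrict_updateFinset]
        rw [lintegral_const_mul _ hH]
        rfl

end RadialWeights

section LowerSemicontinuity

theorem lowerSemicontinuous_lintegral {T α : Type*} [TopologicalSpace T]
    [FirstCountableTopology T] [MeasurableSpace α] {μ : Measure α} {f : T → α → ℝ≥0∞}
    (hmeas : ∀ t, Measurable (f t)) (hf : ∀ a, LowerSemicontinuous fun t => f t a) :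
    LowerSemicontinuous fun t => ∫⁻ a, f t a ∂μ := fun t =>
  lowerSemicontinuousAt_iff_le_liminf.2 <|
    (lintegral_mono fun a => lowerSemicontinuousAt_iff_le_liminf.1 (hf a t)).trans
      (lintegral_liminf_le hmeas)

theorem le_of_ae_le_of_lowerSemicontinuous {T : Type*} [TopologicalSpace T] [MeasurableSpace T]
    {μ : Measure T} [μ.IsOpenPosMeasure] {U : Set T} (hU : IsOpen U) {f c : T → ℝ≥0∞}
    (hf : LowerSemicontinuous f) (hc : ContinuousOn c U) (h : ∀ᵐ t ∂μ, t ∈ U → f t ≤ c t)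
    {t : T} (ht : t ∈ U) : f t ≤ c t := by
  by_contra! hlt
  obtain ⟨m, hcm, hmf⟩ := exists_between hlt
  have near : ∀ᶠ s in 𝓝 t, s ∈ U ∧ c s < m ∧ m < f s := by
    filter_upwards [hU.mem_nhds ht, (hc.continuousAt (hU.mem_nhds ht)).eventually_lt_const hcm,
      hf t m hmf] with s h₁ h₂ h₃ using ⟨h₁, h₂, h₃⟩
  obtain ⟨V, hV, hVo, htV⟩ := eventually_nhds_iff.1 near
  refine hVo.measure_ne_zero μ ⟨t, htV⟩ (measure_mono_null (fun s hs => ?_) h)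
  obtain ⟨hsU, hcs, hfs⟩ := hV s hs
  exact fun hle => (hcs.trans hfs).not_ge (hle hsU)

end LowerSemicontinuity

section Shells

/-- The total surface area `|S^{N-1}|` of the unit sphere of `ℝ^N`. -/
def sphereArea (N : ℕ) : ℝ :=
  (volume : Measure (EuclideanSpace ℝ (Fin N))).toSphere.real Set.univ

/-- The density `|S^{N-1}| s^{N/2 - 1} / 2` of the image of Lebesgue measure of `ℝ^N` under the
energy `x ↦ |x|²`; disintegrating along this map weighs the uniform measure of the sphere of
radius `√s` by it. -/
def shellDensity (N : ℕ) (s : ℝ) : ℝ := sphereArea N / 2 * √s ^ (N - 2)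

variable {N : ℕ}

theorem sphereArea_pos (hN : N ≠ 0) : 0 < sphereArea N := by
  have : NeZero N := ⟨hN⟩
  have : NeZero (volume : Measure (EuclideanSpace ℝ (Fin N))).toSphere :=
    ⟨Measure.toSphere_ne_zero _⟩
  exact measureReal_univ_pos

theorem shellDensity_nonneg (s : ℝ) : 0 ≤ shellDensity N s := by
  unfold shellDensity sphereArea; positivity

theorem shellDensity_pos (hN : N ≠ 0) {s : ℝ} (hs : 0 < s) : 0 < shellDensity N s := by
  have := sphereArea_pos hN
  unfold shellDensity; positivity

theorem continuous_shellDensity : Continuous (shellDensity N) := by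
  unfold shellDensity; fun_prop

theorem isProbabilityMeasure_unitSphereUnif (hN : N ≠ 0) :
    IsProbabilityMeasure (unitSphereUnif N) := by
  have : NeZero N := ⟨hN⟩
  have : NeZero (volume : Measure (EuclideanSpace ℝ (Fin N))).toSphere :=
    ⟨Measure.toSphere_ne_zero _⟩
  exact isProbabilityMeasureSMul

theorem isProbabilityMeasure_sphereUnif (hN : N ≠ 0) (r : ℝ) :
    IsProbabilityMeasure (sphereUnif N r) :=
  have := isProbabilityMeasure_unitSphereUnif hN
  Measure.isProbabilityMeasure_map (by fun_prop)

theorem toSphere_eq_smul_unitSphereUnif (hN : N ≠ 0) :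
    (volume : Measure (EuclideanSpace ℝ (Fin N))).toSphere
      = ENNReal.ofReal (sphereArea N) • unitSphereUnif N := by
  have : NeZero N := ⟨hN⟩
  rw [unitSphereUnif, sphereArea, ofReal_measureReal, smul_smul, ENNReal.mul_inv_cancel, one_smul]
  · exact Measure.measure_univ_ne_zero.2 (Measure.toSphere_ne_zero _)
  · exact measure_ne_top _ _

theorem lintegral_sphereUnif {F : EuclideanSpace ℝ (Fin N) → ℝ≥0∞} (hF : Measurable F) (r : ℝ) :
    ∫⁻ x, F x ∂sphereUnif N r
      = ∫⁻ y, F (r • (y : EuclideanSpace ℝ (Fin N))) ∂unitSphereUnif N :=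
  lintegral_map hF (by fun_prop)

theorem ae_sphereUnif_norm_eq {r : ℝ} (hr : 0 ≤ r) : ∀ᵐ x ∂sphereUnif N r, ‖x‖ = r := by
  refine (ae_map_iff (by fun_prop) (measurableSet_eq_fun (by fun_prop) (by fun_prop))).2
    (.of_forall fun y => ?_)
  rw [norm_smul, norm_eq_of_mem_sphere, mul_one, Real.norm_of_nonneg hr]

theorem lintegral_eq_lintegral_toSphere {E : Type*} [NormedAddCommGroup E] [NormedSpace ℝ E]
    [MeasurableSpace E] [BorelSpace E] [FiniteDimensional ℝ E] [Nontrivial E] (μ : Measure E)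
    [μ.IsAddHaarMeasure] {F : E → ℝ≥0∞} (hF : Measurable F) :
    ∫⁻ x, F x ∂μ = ∫⁻ ρ in Set.Ioi (0 : ℝ), ENNReal.ofReal (ρ ^ (Module.finrank ℝ E - 1)) *
      ∫⁻ y, F (ρ • (y : E)) ∂μ.toSphere := by
  have polar : ∀ x : ({0}ᶜ : Set E), F x = (fun p : Metric.sphere (0 : E) 1 × Set.Ioi (0 : ℝ) =>
      F ((p.2 : ℝ) • (p.1 : E))) (homeomorphUnitSphereProd E x) := fun x => by
    simp only [homeomorphUnitSphereProd_apply_fst_coe, homeomorphUnitSphereProd_apply_snd_coe]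
    rw [smul_inv_smul₀ (norm_ne_zero_iff.2 x.2)]
  have hmeas : Measurable (fun p : Metric.sphere (0 : E) 1 × Set.Ioi (0 : ℝ) =>
      F ((p.2 : ℝ) • (p.1 : E))) := by fun_prop
  rw [← restrict_compl_singleton (μ := μ) 0,
    ← lintegral_subtype_comap (measurableSet_singleton _).compl, lintegral_congr polar,
    μ.measurePreserving_homeomorphUnitSphereProd.lintegral_comp hmeas,
    lintegral_prod_symm' _ hmeas, Measure.volumeIoiPow,
    lintegral_withDensity_eq_lintegral_mul _ (by fun_prop) hmeas.lintegral_prod_left']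
  simp only [Pi.mul_apply]
  rw [lintegral_subtype_comap measurableSet_Ioi (fun ρ : ℝ =>
    ENNReal.ofReal (ρ ^ (Module.finrank ℝ E - 1)) * ∫⁻ y, F (ρ • (y : E)) ∂μ.toSphere),
    restrict_compl_singleton]

theorem lintegral_eq_lintegral_shellDensity_mul (hN : 2 ≤ N)
    {F : EuclideanSpace ℝ (Fin N) → ℝ≥0∞} (hF : Measurable F) :
    ∫⁻ x, F x = ∫⁻ s in Set.Ioi (0 : ℝ),
      ENNReal.ofReal (shellDensity N s) * ∫⁻ x, F x ∂sphereUnif N √s := by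
  have hN0 : N ≠ 0 := by omega
  have : NeZero N := ⟨hN0⟩
  rw [lintegral_eq_lintegral_toSphere volume hF]
  refine Eq.trans ?_ (setLIntegral_two_mul_comp_sq _)
  refine setLIntegral_congr_fun measurableSet_Ioi fun ρ hρ => ?_
  have hρ : 0 < ρ := hρ
  have weight : ρ ^ (N - 1) * sphereArea N = 2 * ρ * (sphereArea N / 2 * ρ ^ (N - 2)) := by
    rw [show N - 1 = N - 2 + 1 by omega, pow_succ]
    ring
  simp only [toSphere_eq_smul_unitSphereUnif hN0, lintegral_smul_measure, smul_eq_mul,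
    lintegral_sphereUnif hF, finrank_euclideanSpace_fin, shellDensity, Real.sqrt_sq hρ.le]
  rw [← mul_assoc, ← mul_assoc, ← ENNReal.ofReal_mul (by positivity),
    ← ENNReal.ofReal_mul (by positivity), weight]

end Shells

section ProductsOnSpheres

variable {N : ℕ} {i k : Fin N}

theorem measurable_lintegral_sphereUnif_sqrt (hN : N ≠ 0)
    {F : EuclideanSpace ℝ (Fin N) → ℝ≥0∞} (hF : Measurable F) :
    Measurable fun s : ℝ => ∫⁻ x, F x ∂sphereUnif N √s := by
  have := isProbabilityMeasure_unitSphereUnif hN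
  simp_rw [lintegral_sphereUnif hF]
  exact Measurable.lintegral_prod_right' (ν := unitSphereUnif N)
    (f := fun p : ℝ × Metric.sphere (0 : EuclideanSpace ℝ (Fin N)) 1 =>
      F (√p.1 • (p.2 : EuclideanSpace ℝ (Fin N)))) (by fun_prop)

theorem lowerSemicontinuous_lintegral_sphereUnif_sqrt {F : EuclideanSpace ℝ (Fin N) → ℝ≥0∞}
    (hF : LowerSemicontinuous F) : LowerSemicontinuous fun s : ℝ => ∫⁻ x, F x ∂sphereUnif N √s := by
  simp_rw [lintegral_sphereUnif hF.measurable]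
  exact lowerSemicontinuous_lintegral (fun s => hF.measurable.comp (by fun_prop))
    fun y => hF.comp (g := fun s : ℝ => √s • (y : EuclideanSpace ℝ (Fin N))) (by fun_prop)

theorem ae_shellDensity_mul_lintegral_restrict_le (hik : i ≠ k)
    {H : (({i, k}ᶜ : Finset (Fin N)) → ℝ) → ℝ≥0∞} (hH : Measurable H) :
    ∀ᵐ s, s ∈ Set.Ioi (0 : ℝ) → ENNReal.ofReal (shellDensity N s) *
        ∫⁻ x, H (({i, k}ᶜ : Finset (Fin N)).restrict x.ofLp) ∂sphereUnif N √s
      ≤ ENNReal.ofReal Real.pi * ∫⁻ y, H y := by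
  have hN : 2 ≤ N := by have := Fin.val_ne_of_ne hik; omega
  refine (ae_restrict_iff' measurableSet_Ioi).1
    (ae_le_of_forall_setLIntegral_le_of_sigmaFinite
      (continuous_shellDensity.measurable.ennreal_ofReal.mul
        (measurable_lintegral_sphereUnif_sqrt (by omega) (by fun_prop))) fun B hB _ => ?_)
  rw [Measure.restrict_restrict hB]
  set g : ℝ → ℝ≥0∞ := (B ∩ Set.Ioi 0).indicator 1
  have hBpos : MeasurableSet (B ∩ Set.Ioi (0 : ℝ)) := hB.inter measurableSet_Ioi
  have hg : Measurable g := measurable_one.indicator hBpos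
  have on_shell : ∀ s ∈ Set.Ioi (0 : ℝ),
      ∫⁻ x, g (∑ j, x.ofLp j ^ 2) *
          H (({i, k}ᶜ : Finset (Fin N)).restrict x.ofLp) ∂sphereUnif N √s
        = g s * ∫⁻ x, H (({i, k}ᶜ : Finset (Fin N)).restrict x.ofLp) ∂sphereUnif N √s := by
    intro s hs
    rw [← lintegral_const_mul _ (by fun_prop)]
    refine lintegral_congr_ae ?_
    filter_upwards [ae_sphereUnif_norm_eq (N := N) (Real.sqrt_nonneg s)] with x hx
    rw [← EuclideanSpace.real_norm_sq_eq, hx, Real.sq_sqrt (Set.mem_Ioi.1 hs).le]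
  calc ∫⁻ s in B ∩ Set.Ioi 0, ENNReal.ofReal (shellDensity N s) *
          ∫⁻ x, H (({i, k}ᶜ : Finset (Fin N)).restrict x.ofLp) ∂sphereUnif N √s
      = ∫⁻ s in Set.Ioi (0 : ℝ), ENNReal.ofReal (shellDensity N s) *
          (g s * ∫⁻ x, H (({i, k}ᶜ : Finset (Fin N)).restrict x.ofLp) ∂sphereUnif N √s) := by
        rw [← lintegral_indicator hBpos, ← lintegral_indicator measurableSet_Ioi]
        refine lintegral_congr fun s => ?_
        by_cases hs : 0 < s <;> by_cases hsB : s ∈ B <;> simp [g, hs, hsB]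
    _ = ∫⁻ x : EuclideanSpace ℝ (Fin N), g (∑ j, x.ofLp j ^ 2) *
          H (({i, k}ᶜ : Finset (Fin N)).restrict x.ofLp) := by
        rw [lintegral_eq_lintegral_shellDensity_mul hN (by fun_prop)]
        exact setLIntegral_congr_fun measurableSet_Ioi fun s hs => by simp only [on_shell s hs]
    _ = ∫⁻ x : Fin N → ℝ, g (∑ j, x j ^ 2) * H (({i, k}ᶜ : Finset (Fin N)).restrict x) :=
        (PiLp.volume_preserving_ofLp (Fin N)).lintegral_comp (f := fun x : Fin N → ℝ =>
          g (∑ j, x j ^ 2) * H (({i, k}ᶜ : Finset (Fin N)).restrict x)) (by fun_prop)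
    _ ≤ (ENNReal.ofReal Real.pi * ∫⁻ u, g u) * ∫⁻ y, H y :=
        lintegral_comp_sum_sq_mul_restrict_le hik hg hH
    _ = ∫⁻ _ in B ∩ Set.Ioi 0, ENNReal.ofReal Real.pi * ∫⁻ y, H y := by
        rw [lintegral_indicator_one hBpos, setLIntegral_const]
        ring

theorem shellDensity_mul_lintegral_restrict_le_of_lowerSemicontinuous (hik : i ≠ k)
    {H : (({i, k}ᶜ : Finset (Fin N)) → ℝ) → ℝ≥0∞} (hH : LowerSemicontinuous H)
    {s : ℝ} (hs : 0 < s) :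
    ENNReal.ofReal (shellDensity N s) *
        ∫⁻ x, H (({i, k}ᶜ : Finset (Fin N)).restrict x.ofLp) ∂sphereUnif N √s
      ≤ ENNReal.ofReal Real.pi * ∫⁻ y, H y := by
  have divide : ∀ t ∈ Set.Ioi (0 : ℝ), ∀ a b : ℝ≥0∞,
      ENNReal.ofReal (shellDensity N t) * a ≤ b ↔ a ≤ (ENNReal.ofReal (shellDensity N t))⁻¹ * b :=
    fun t ht a b => ENNReal.mul_le_iff_le_inv
      (ENNReal.ofReal_pos.2 (shellDensity_pos i.pos.ne' ht)).ne' ENNReal.ofReal_ne_top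
  rw [divide s hs]
  refine le_of_ae_le_of_lowerSemicontinuous (μ := volume) isOpen_Ioi
    (lowerSemicontinuous_lintegral_sphereUnif_sqrt (hH.comp
      (g := fun x : EuclideanSpace ℝ (Fin N) => ({i, k}ᶜ : Finset (Fin N)).restrict x.ofLp)
      (by fun_prop)))
    (c := fun t => (ENNReal.ofReal (shellDensity N t))⁻¹ * _) (fun t _ => ?_) ?_ hs
  · exact (ENNReal.Tendsto.mul_const
      (ENNReal.continuous_ofReal.comp continuous_shellDensity).inv.continuousAt.tendsto
      (Or.inl (ENNReal.inv_ne_zero.2 ENNReal.ofReal_ne_top))).mono_left nhdsWithin_le_nhds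
  · filter_upwards [ae_shellDensity_mul_lintegral_restrict_le hik hH.measurable] with t h ht
    exact (divide t ht _ _).1 (h ht)

theorem shellDensity_mul_lintegral_restrict_le (hik : i ≠ k)
    {H : (({i, k}ᶜ : Finset (Fin N)) → ℝ) → ℝ≥0∞} (hH : Measurable H) {s : ℝ} (hs : 0 < s) :
    ENNReal.ofReal (shellDensity N s) *
        ∫⁻ x, H (({i, k}ᶜ : Finset (Fin N)).restrict x.ofLp) ∂sphereUnif N √s
      ≤ ENNReal.ofReal Real.pi * ∫⁻ y, H y := by
  have pi_ne_zero : ENNReal.ofReal Real.pi ≠ 0 := (ENNReal.ofReal_pos.2 Real.pi_pos).ne'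
  refine ENNReal.le_of_forall_pos_le_add fun ε hε _ => ?_
  obtain ⟨G, hHG, hG, hGint⟩ := exists_le_lowerSemicontinuous_lintegral_ge volume H hH
    (ε := ε / ENNReal.ofReal Real.pi)
    (ENNReal.div_pos (ENNReal.coe_pos.2 hε).ne' ENNReal.ofReal_ne_top).ne'
  calc _ ≤ ENNReal.ofReal (shellDensity N s) *
          ∫⁻ x, G (({i, k}ᶜ : Finset (Fin N)).restrict x.ofLp) ∂sphereUnif N √s := by
        gcongr with x
        exact hHG _
    _ ≤ ENNReal.ofReal Real.pi * ∫⁻ y, G y :=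
        shellDensity_mul_lintegral_restrict_le_of_lowerSemicontinuous hik hG hs
    _ ≤ ENNReal.ofReal Real.pi * ((∫⁻ y, H y) + ε / ENNReal.ofReal Real.pi) := by gcongr
    _ = _ := by rw [mul_add, ENNReal.mul_div_cancel pi_ne_zero ENNReal.ofReal_ne_top]

variable {F : Fin N → ℝ → ℝ≥0∞} {q s : ℝ}

theorem shellDensity_mul_lintegral_prod_le (hN : 3 ≤ N) (hF : ∀ j, Measurable (F j))
    (hq : q = N / (N - 2)) (hs : 0 < s) :
    ENNReal.ofReal (shellDensity N s) * ∫⁻ x, ∏ j, F j (x j) ∂sphereUnif N √s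
      ≤ ENNReal.ofReal Real.pi * ∏ j, (∫⁻ u, F j u ^ q) ^ (1 / q) := by
  obtain ⟨n, rfl⟩ : ∃ n, N = n + 2 := ⟨N - 2, by omega⟩
  have no_fixed_point : ∀ i : Fin (n + 2), finRotate (n + 2) i ≠ i := fun i => by simp
  rw [← smul_eq_mul, ← lintegral_smul_measure]
  refine lintegral_prod_le_of_compl_pair (by simpa using hN) no_fixed_point
    (fun j => ((hF j).comp (by fun_prop)).aemeasurable) (by simpa using hq) fun i => ?_
  set A : Finset (Fin (n + 2)) := {i, finRotate (n + 2) i}ᶜ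
  have bound := shellDensity_mul_lintegral_restrict_le (no_fixed_point i).symm
    (H := fun y => ∏ j, F j.1 (y j) ^ q) (by fun_prop) hs
  rw [volume_pi,
    lintegral_pi_prod_eq_prod (F := fun (j : A) u => F j u ^ q) fun j => (hF j).pow_const q,
    Finset.prod_coe_sort A fun j => ∫⁻ u, F j u ^ q] at bound
  rw [lintegral_smul_measure, smul_eq_mul]
  refine le_of_eq_of_le ?_ bound
  congr 1
  exact lintegral_congr fun x => (Finset.prod_coe_sort A fun j => F j (x j) ^ q).symm

end ProductsOnSpheres

section TensorPowers

theorem prod_sub_prod_eq_sum {ι R : Type*} [Fintype ι] [LinearOrder ι] [CommRing R] (a b : ι → R) :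
    ∏ j, a j - ∏ j, b j
      = ∑ i, ∏ j, if j < i then a j else if i < j then b j else a j - b j := by
  have telescope := Finset.prod_add_ordered Finset.univ b (fun j => a j - b j)
  simp only [add_sub_cancel] at telescope
  rw [telescope, add_sub_cancel_left]
  refine Finset.sum_congr rfl fun i _ => ?_
  have not_lt_and_lt : ∀ j, j ∈ (Finset.univ.filter fun j => ¬ j < i).filter (fun j => ¬ i < j) ↔
      j ∈ ({i} : Finset ι) := fun j => by
    simp [le_antisymm_iff, and_comm]
  have lt_of_not_lt : (Finset.univ.filter fun j => ¬ j < i).filter (fun j => i < j)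
      = Finset.univ.filter fun j => i < j := by
    ext j
    simpa using le_of_lt
  rw [Finset.prod_ite, Finset.prod_ite, Finset.ext not_lt_and_lt, lt_of_not_lt,
    Finset.prod_singleton]
  ring

variable {N : ℕ} {q r s : ℝ}

theorem quasiMeasurePreserving_eval_sphereUnif (hN : 3 ≤ N) (hr : 0 < r) (j : Fin N) :
    Measure.QuasiMeasurePreserving (fun x : EuclideanSpace ℝ (Fin N) => x j) (sphereUnif N r)
      volume := by
  refine ⟨by fun_prop, Measure.AbsolutelyContinuous.mk fun A hA hA0 => ?_⟩
  obtain ⟨q, hq⟩ : ∃ q : ℝ, q = N / (N - 2) := ⟨_, rfl⟩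
  have hN3 : (3 : ℝ) ≤ N := by exact_mod_cast hN
  have hq0 : 0 < q := hq ▸ div_pos (by linarith) (by linarith)
  have bound := shellDensity_mul_lintegral_prod_le (s := r ^ 2) hN
    (F := fun i u => if i = j then A.indicator 1 u else 1)
    (fun i => by split_ifs <;> [exact measurable_one.indicator hA; exact measurable_const])
    hq (by positivity)
  have vanish : ∏ i : Fin N,
      (∫⁻ u, (if i = j then A.indicator 1 u else 1 : ℝ≥0∞) ^ q) ^ (1 / q) = 0 := by
    refine Finset.prod_eq_zero (Finset.mem_univ j) ?_
    have indicator_rpow : (fun u => A.indicator (1 : ℝ → ℝ≥0∞) u ^ q) = A.indicator 1 := by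
      ext u
      by_cases hu : u ∈ A <;> simp [hu, hq0]
    simp [indicator_rpow, lintegral_indicator_one hA, hA0, hq0]
  rw [vanish, mul_zero, Real.sqrt_sq hr.le, nonpos_iff_eq_zero, mul_eq_zero, or_iff_right
    (ENNReal.ofReal_pos.2 (shellDensity_pos (by omega) (by positivity))).ne'] at bound
  simp only [Finset.prod_ite_eq', Finset.mem_univ, if_true] at bound
  rw [Measure.map_apply (by fun_prop) hA, ← lintegral_indicator_one (hA.preimage (by fun_prop))]
  exact bound

variable {F : Fin N → ℝ → ℝ}

theorem shellDensity_mul_lintegral_enorm_prod_le (hN : 3 ≤ N)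
    (hF : ∀ j, AEStronglyMeasurable (F j)) (hq : q = N / (N - 2)) (hs : 0 < s) :
    ENNReal.ofReal (shellDensity N s) * ∫⁻ x, ∏ j, ‖F j (x j)‖ₑ ∂sphereUnif N √s
      ≤ ENNReal.ofReal Real.pi * ∏ j, eLpNorm (F j) (ENNReal.ofReal q) := by
  have hN3 : (3 : ℝ) ≤ N := by exact_mod_cast hN
  have hq0 : 0 < q := hq ▸ div_pos (by linarith) (by linarith)
  have bound := shellDensity_mul_lintegral_prod_le (F := fun j u => ‖(hF j).mk _ u‖ₑ) hN
    (fun j => (hF j).stronglyMeasurable_mk.measurable.enorm) hq hs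
  have ae_mk : ∀ᵐ x ∂sphereUnif N √s, ∀ j, F j (x j) = (hF j).mk _ (x j) :=
    ae_all_iff.2 fun j => (quasiMeasurePreserving_eval_sphereUnif hN (Real.sqrt_pos.2 hs) j).ae_eq
      (hF j).ae_eq_mk
  convert! bound using 2
  · refine lintegral_congr_ae ?_
    filter_upwards [ae_mk] with x hx
    simp only [hx]
  · refine Finset.prod_congr rfl fun j _ => ?_
    rw [eLpNorm_congr_ae (hF j).ae_eq_mk, eLpNorm_eq_lintegral_rpow_enorm_toReal
      (ENNReal.ofReal_pos.2 hq0).ne' ENNReal.ofReal_ne_top, ENNReal.toReal_ofReal hq0.le]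

variable {f g : ℝ → ℝ} {M : ℝ≥0∞}

theorem tensorPow_ae_eq (hN : 3 ≤ N) (hr : 0 < r) (h : f =ᵐ[volume] g) :
    tensorPow f N =ᵐ[sphereUnif N r] tensorPow g N := by
  have coord : ∀ᵐ x ∂sphereUnif N r, ∀ j, f (x j) = g (x j) :=
    ae_all_iff.2 fun j => (quasiMeasurePreserving_eval_sphereUnif hN hr j).ae_eq h
  filter_upwards [coord] with x hx
  simp only [tensorPow, hx]

theorem Z_congr_ae (hN : 3 ≤ N) (hr : 0 < r) (h : f =ᵐ[volume] g) : Z N f r = Z N g r :=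
  integral_congr_ae (tensorPow_ae_eq hN hr h)

theorem enorm_tensorPow (f : ℝ → ℝ) (x : EuclideanSpace ℝ (Fin N)) :
    ‖tensorPow f N x‖ₑ = ∏ j, ‖f (x j)‖ₑ := by
  simp only [tensorPow, enorm_eq_nnnorm, nnnorm_prod, ENNReal.ofNNReal_finsetProd]

theorem aestronglyMeasurable_tensorPow (hN : 3 ≤ N) (hr : 0 < r) (hf : AEStronglyMeasurable f) :
    AEStronglyMeasurable (tensorPow f N) (sphereUnif N r) :=
  Finset.aestronglyMeasurable_fun_prod _ fun j _ =>
    hf.comp_quasiMeasurePreserving (quasiMeasurePreserving_eval_sphereUnif hN hr j)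

theorem integrable_tensorPow (hN : 3 ≤ N) (hq : q = N / (N - 2)) (hr : 0 < r)
    (hf : MemLp f (ENNReal.ofReal q)) : Integrable (tensorPow f N) (sphereUnif N r) := by
  refine ⟨aestronglyMeasurable_tensorPow hN hr hf.1, ?_⟩
  have bound := shellDensity_mul_lintegral_enorm_prod_le (F := fun _ => f) hN (fun _ => hf.1) hq
    (pow_pos hr 2)
  rw [Real.sqrt_sq hr.le, Finset.prod_const] at bound
  simp only [HasFiniteIntegral, enorm_tensorPow]
  refine lt_top_iff_ne_top.2 fun htop => ?_
  rw [htop, ENNReal.mul_top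
    (ENNReal.ofReal_pos.2 (shellDensity_pos (by omega) (pow_pos hr 2))).ne', top_le_iff] at bound
  exact ENNReal.mul_ne_top ENNReal.ofReal_ne_top (ENNReal.pow_ne_top hf.2.ne) bound

/-- The density at `s` of the energy `∑ j, v j ^ 2` when the `N` velocities are independent with
density `f`: the mass that `f^{⊗N}` gives to the shell of radius `√s`. -/
def energyDensity (N : ℕ) (f : ℝ → ℝ) (s : ℝ) : ℝ := shellDensity N s * Z N f √s

theorem energyDensity_of_nonpos (hN : 3 ≤ N) (hs : s ≤ 0) : energyDensity N f s = 0 := by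
  rw [energyDensity, shellDensity, Real.sqrt_eq_zero_of_nonpos hs, zero_pow (by omega), mul_zero,
    zero_mul]

theorem energyDensity_nonneg (hN : 3 ≤ N) (hf : ∀ᵐ v, 0 ≤ f v) : 0 ≤ energyDensity N f s := by
  rcases le_or_gt s 0 with hs | hs
  · rw [energyDensity_of_nonpos hN hs]
  · refine mul_nonneg (shellDensity_nonneg s) (integral_nonneg_of_ae ?_)
    filter_upwards [ae_all_iff.2 fun j =>
      (quasiMeasurePreserving_eval_sphereUnif hN (Real.sqrt_pos.2 hs) j).ae hf] with x hx
    exact Finset.prod_nonneg fun j _ => hx j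

theorem enorm_energyDensity_le (hN : 3 ≤ N) (hq : q = N / (N - 2)) (hf : AEStronglyMeasurable f)
    (s : ℝ) :
    ‖energyDensity N f s‖ₑ ≤ ENNReal.ofReal Real.pi * eLpNorm f (ENNReal.ofReal q) ^ N := by
  rcases le_or_gt s 0 with hs | hs
  · simp [energyDensity_of_nonpos hN hs]
  calc ‖energyDensity N f s‖ₑ
      ≤ ENNReal.ofReal (shellDensity N s) * ∫⁻ x, ∏ j, ‖f (x j)‖ₑ ∂sphereUnif N √s := by
        rw [energyDensity, enorm_mul, Real.enorm_of_nonneg (shellDensity_nonneg s)]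
        simp_rw [← enorm_tensorPow]
        gcongr
        exact enorm_integral_le_lintegral_enorm _
    _ ≤ _ := by
        simpa using
          shellDensity_mul_lintegral_enorm_prod_le (F := fun _ => f) hN (fun _ => hf) hq hs

theorem enorm_tensorPow_sub_le (f g : ℝ → ℝ) (x : EuclideanSpace ℝ (Fin N)) :
    ‖tensorPow f N x - tensorPow g N x‖ₑ
      ≤ ∑ i, ∏ j, ‖(if j < i then f else if i < j then g else f - g) (x j)‖ₑ := by
  rw [tensorPow, tensorPow, prod_sub_prod_eq_sum]
  refine (enorm_sum_le _ _).trans_eq (Finset.sum_congr rfl fun i _ => ?_)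
  rw [enorm_eq_nnnorm, nnnorm_prod, ENNReal.ofNNReal_finsetProd]
  refine Finset.prod_congr rfl fun j _ => ?_
  split_ifs <;> rfl

theorem enorm_energyDensity_sub_le (hN : 3 ≤ N) (hq : q = N / (N - 2))
    (hf : MemLp f (ENNReal.ofReal q)) (hg : MemLp g (ENNReal.ofReal q))
    (hfM : eLpNorm f (ENNReal.ofReal q) ≤ M) (hgM : eLpNorm g (ENNReal.ofReal q) ≤ M) (s : ℝ) :
    ‖energyDensity N f s - energyDensity N g s‖ₑ
      ≤ ENNReal.ofReal Real.pi * (N * (M ^ (N - 1) * eLpNorm (f - g) (ENNReal.ofReal q))) := by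
  rcases le_or_gt s 0 with hs | hs
  · simp [energyDensity_of_nonpos hN hs]
  have hr := Real.sqrt_pos.2 hs
  set F : Fin N → Fin N → ℝ → ℝ := fun i j => if j < i then f else if i < j then g else f - g
  have hF : ∀ i j, AEStronglyMeasurable (F i j) := fun i j => by
    simp only [F]
    split_ifs
    exacts [hf.1, hg.1, hf.1.sub hg.1]
  have prod_norm : ∀ i, ∏ j, eLpNorm (F i j) (ENNReal.ofReal q)
      ≤ M ^ (N - 1) * eLpNorm (f - g) (ENNReal.ofReal q) := by
    intro i
    rw [← Finset.prod_erase_mul _ _ (Finset.mem_univ i)]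
    simp only [F, lt_irrefl, if_false]
    gcongr
    refine (Finset.prod_le_pow_card _ _ M fun j hj => ?_).trans_eq (by simp)
    rcases lt_or_gt_of_ne (Finset.ne_of_mem_erase hj) with hji | hij
    · rwa [if_pos hji]
    · rwa [if_neg hij.not_gt, if_pos hij]
  calc ‖energyDensity N f s - energyDensity N g s‖ₑ
      ≤ ENNReal.ofReal (shellDensity N s) *
          ∫⁻ x, ∑ i, ∏ j, ‖F i j (x j)‖ₑ ∂sphereUnif N √s := by
        rw [energyDensity, energyDensity, ← mul_sub, enorm_mul,
          Real.enorm_of_nonneg (shellDensity_nonneg s), Z, Z,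
          ← integral_sub (integrable_tensorPow hN hq hr hf) (integrable_tensorPow hN hq hr hg)]
        gcongr
        exact (enorm_integral_le_lintegral_enorm _).trans
          (lintegral_mono fun x => enorm_tensorPow_sub_le f g x)
    _ = ∑ i, ENNReal.ofReal (shellDensity N s) * ∫⁻ x, ∏ j, ‖F i j (x j)‖ₑ ∂sphereUnif N √s := by
        rw [lintegral_finsetSum', Finset.mul_sum]
        exact fun i _ => Finset.aemeasurable_fun_prod _ fun j _ =>
          ((hF i j).comp_quasiMeasurePreserving
            (quasiMeasurePreserving_eval_sphereUnif hN hr j)).enorm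
    _ ≤ ∑ _i : Fin N, ENNReal.ofReal Real.pi *
          (M ^ (N - 1) * eLpNorm (f - g) (ENNReal.ofReal q)) := by
        refine Finset.sum_le_sum fun i _ =>
          (shellDensity_mul_lintegral_enorm_prod_le hN (hF i) hq hs).trans ?_
        gcongr
        exact prod_norm i
    _ = _ := by
        rw [Finset.sum_const, Finset.card_univ, Fintype.card_fin, nsmul_eq_mul]
        ring

theorem continuous_energyDensity_of_bounded (hN : N ≠ 0) (hg : Continuous g) {B : ℝ}
    (hB : ∀ u, ‖g u‖ ≤ B) : Continuous (energyDensity N g) := by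
  have := isProbabilityMeasure_unitSphereUnif hN
  have Z_sqrt : ∀ s, Z N g √s = ∫ y, tensorPow g N (√s • (y : EuclideanSpace ℝ (Fin N)))
      ∂unitSphereUnif N := fun s =>
    integral_map (by fun_prop) (by unfold tensorPow; fun_prop)
  refine continuous_shellDensity.mul ?_
  simp_rw [Z_sqrt]
  refine continuous_of_dominated (bound := fun _ => B ^ N) (fun s => ?_) (fun s => ?_)
    (integrable_const _) (.of_forall fun y => ?_)
  · exact Continuous.aestronglyMeasurable (by unfold tensorPow; fun_prop)
  · refine .of_forall fun y => ?_
    rw [tensorPow, norm_prod]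
    exact (Finset.prod_le_prod (fun _ _ => norm_nonneg _) fun j _ => hB _).trans_eq (by simp)
  · unfold tensorPow
    fun_prop

theorem exists_continuous_enorm_energyDensity_sub_lt (hN : 3 ≤ N) (hq : q = N / (N - 2))
    (hf : MemLp f (ENNReal.ofReal q)) {ε : ℝ≥0∞} (hε : ε ≠ 0) :
    ∃ G : ℝ → ℝ, Continuous G ∧ ∀ s, ‖energyDensity N f s - G s‖ₑ < ε := by
  have hq1 : 1 ≤ ENNReal.ofReal q := by
    have hN3 : (3 : ℝ) ≤ N := by exact_mod_cast hN
    rw [← ENNReal.ofReal_one, hq]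
    exact ENNReal.ofReal_le_ofReal ((one_le_div (by linarith)).2 (by linarith))
  obtain ⟨M, hM⟩ : ∃ M, M = eLpNorm f (ENNReal.ofReal q) + 1 := ⟨_, rfl⟩
  have hKtop : ENNReal.ofReal Real.pi * (N * M ^ (N - 1)) ≠ ⊤ := by
    rw [hM]
    exact ENNReal.mul_ne_top ENNReal.ofReal_ne_top (ENNReal.mul_ne_top (ENNReal.natCast_ne_top N)
      (ENNReal.pow_ne_top (ENNReal.add_ne_top.2 ⟨hf.2.ne, ENNReal.one_ne_top⟩)))
  obtain ⟨δ, hδ, hδε⟩ := ENNReal.exists_nnreal_pos_mul_lt hKtop hε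
  obtain ⟨g, hgc, hfg, hg, hgLp⟩ := hf.exists_hasCompactSupport_eLpNorm_sub_le
    ENNReal.ofReal_ne_top (ε := min δ 1) (by simpa using hδ.ne')
  obtain ⟨B, hB⟩ := hgc.exists_bound_of_continuous hg
  have hgM : eLpNorm g (ENNReal.ofReal q) ≤ M := by
    have triangle := eLpNorm_sub_le hf.1 (hf.1.sub hgLp.1) hq1
    rw [sub_sub_cancel] at triangle
    exact hM ▸ triangle.trans (add_le_add le_rfl (hfg.trans (min_le_right _ _)))
  refine ⟨energyDensity N g, continuous_energyDensity_of_bounded (by omega) hg hB, fun s => ?_⟩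
  refine (enorm_energyDensity_sub_le hN hq hf hgLp (hM ▸ le_self_add) hgM s).trans_lt
    (lt_of_le_of_lt ?_ hδε)
  rw [← mul_assoc, ← mul_assoc, mul_comm, mul_assoc]
  exact mul_le_mul_left (hfg.trans (min_le_left _ _)) _

theorem continuous_energyDensity (hN : 3 ≤ N) (hq : q = N / (N - 2))
    (hf : MemLp f (ENNReal.ofReal q)) : Continuous (energyDensity N f) := by
  refine continuous_of_uniform_approx_of_continuous fun u hu => ?_
  obtain ⟨ε, hε, hεu⟩ := mem_uniformity_edist.1 hu
  obtain ⟨G, hG, hfG⟩ := exists_continuous_enorm_energyDensity_sub_lt hN hq hf hε.ne'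
  exact ⟨G, hG, fun s => hεu ((edist_eq_enorm_sub _ _).trans_lt (hfG s))⟩

end TensorPowers

section EnergyLaw

theorem pi_withDensity_eq_withDensity_prod {ι : Type*} [Fintype ι] {X : ι → Type*}
    [∀ i, MeasurableSpace (X i)] {μ : ∀ i, Measure (X i)} [∀ i, SigmaFinite (μ i)]
    {F : ∀ i, X i → ℝ≥0∞} [∀ i, SigmaFinite ((μ i).withDensity (F i))]
    (hF : ∀ i, Measurable (F i)) :
    Measure.pi (fun i => (μ i).withDensity (F i))
      = (Measure.pi μ).withDensity fun x => ∏ i, F i (x i) := by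
  classical
  refine Measure.pi_eq fun A hA => ?_
  rw [withDensity_apply _ (MeasurableSet.univ_pi hA), ← lintegral_indicator (.univ_pi hA)]
  have split : ∀ x : ∀ i, X i, (Set.univ.pi A).indicator (fun x => ∏ i, F i (x i)) x
      = ∏ i, (A i).indicator (F i) (x i) := by
    intro x
    by_cases hx : x ∈ Set.univ.pi A
    · rw [Set.indicator_of_mem hx]
      exact Finset.prod_congr rfl fun i _ => (Set.indicator_of_mem (hx i trivial) _).symm
    · obtain ⟨i, hi⟩ : ∃ i, x i ∉ A i := by simpa using hx
      rw [Set.indicator_of_notMem hx, Finset.prod_eq_zero (Finset.mem_univ i)]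
      exact Set.indicator_of_notMem hi _
  simp_rw [split]
  rw [lintegral_pi_prod_eq_prod fun i => (hF i).indicator (hA i)]
  exact Finset.prod_congr rfl fun i _ => by
    rw [lintegral_indicator (hA i), withDensity_apply _ (hA i)]

/-- The law on `ℝ` with density `f` of the velocity of one particle. -/
def velocityLaw (f : ℝ → ℝ) : Measure ℝ := volume.withDensity fun v => ENNReal.ofReal (f v)

variable {N : ℕ} {q : ℝ} {f : ℝ → ℝ}

theorem IsProbDensity.isProbabilityMeasure_velocityLaw (hf : IsProbDensity f) :
    IsProbabilityMeasure (velocityLaw f) := by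
  refine ⟨?_⟩
  rw [velocityLaw, withDensity_apply _ .univ, setLIntegral_univ,
    ← ofReal_integral_eq_lintegral_ofReal hf.integrable hf.nonneg, hf.integral_eq_one,
    ENNReal.ofReal_one]

theorem IsProbDensity.congr_ae (hf : IsProbDensity f) {g : ℝ → ℝ} (h : f =ᵐ[volume] g) :
    IsProbDensity g where
  nonneg := by filter_upwards [hf.nonneg, h] with v hv hfg using hfg ▸ hv
  integrable := hf.integrable.congr h
  integral_eq_one := (integral_congr_ae h).symm.trans hf.integral_eq_one

theorem velocityLaw_congr_ae {g : ℝ → ℝ} (h : f =ᵐ[volume] g) : velocityLaw f = velocityLaw g :=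
  withDensity_congr_ae (h.fun_comp ENNReal.ofReal)

theorem energyDensity_congr_ae (hN : 3 ≤ N) {g : ℝ → ℝ} (h : f =ᵐ[volume] g) (s : ℝ) :
    energyDensity N f s = energyDensity N g s := by
  rcases le_or_gt s 0 with hs | hs
  · rw [energyDensity_of_nonpos hN hs, energyDensity_of_nonpos hN hs]
  · rw [energyDensity, energyDensity, Z_congr_ae hN (Real.sqrt_pos.2 hs) h]

theorem lintegral_comp_sum_sq_mul_prod_sphereUnif (hN : 3 ≤ N) (hq : q = N / (N - 2))
    (hf : ∀ᵐ v, 0 ≤ f v) (hfq : MemLp f (ENNReal.ofReal q)) (F : ℝ → ℝ≥0∞) {s : ℝ} (hs : 0 < s) :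
    ∫⁻ x, F (∑ j, x j ^ 2) * ∏ j, ENNReal.ofReal (f (x j)) ∂sphereUnif N √s
      = F s * ENNReal.ofReal (Z N f √s) := by
  have hr := Real.sqrt_pos.2 hs
  have nonneg : ∀ᵐ x ∂sphereUnif N √s, ∀ j, 0 ≤ f (x j) :=
    ae_all_iff.2 fun j => (quasiMeasurePreserving_eval_sphereUnif hN hr j).ae hf
  have integrable := integrable_tensorPow hN hq hr hfq
  have Z_eq : ENNReal.ofReal (Z N f √s)
      = ∫⁻ x, ENNReal.ofReal (tensorPow f N x) ∂sphereUnif N √s :=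
    ofReal_integral_eq_lintegral_ofReal integrable <| by
      filter_upwards [nonneg] with x hx using Finset.prod_nonneg fun j _ => hx j
  rw [Z_eq, ← lintegral_const_mul'' _ integrable.1.aemeasurable.ennreal_ofReal]
  refine lintegral_congr_ae ?_
  filter_upwards [nonneg, ae_sphereUnif_norm_eq hr.le] with x hx hxr
  rw [← EuclideanSpace.real_norm_sq_eq, hxr, Real.sq_sqrt hs.le, tensorPow,
    ENNReal.ofReal_prod_of_nonneg fun j _ => hx j]

theorem map_sum_sq_pi_velocityLaw_of_measurable (hN : 3 ≤ N) (hq : q = N / (N - 2))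
    (hf : IsProbDensity f) (hfq : MemLp f (ENNReal.ofReal q)) (hfm : Measurable f) :
    (Measure.pi fun _ : Fin N => velocityLaw f).map (fun x => ∑ j, x j ^ 2)
      = volume.withDensity fun s => ENNReal.ofReal (energyDensity N f s) := by
  have := hf.isProbabilityMeasure_velocityLaw
  unfold velocityLaw at this ⊢
  have energy_mble : Measurable fun s => ENNReal.ofReal (energyDensity N f s) :=
    (continuous_energyDensity hN hq hfq).measurable.ennreal_ofReal
  refine Measure.ext_of_lintegral _ fun F hF => ?_
  have hFsum : Measurable fun x : Fin N → ℝ => F (∑ j, x j ^ 2) := hF.comp (by fun_prop)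
  rw [pi_withDensity_eq_withDensity_prod fun _ => hfm.ennreal_ofReal,
    lintegral_map hF (by fun_prop), lintegral_withDensity_eq_lintegral_mul _ (by fun_prop) hFsum,
    lintegral_withDensity_eq_lintegral_mul _ energy_mble hF, ← volume_pi,
    ← (PiLp.volume_preserving_ofLp (Fin N)).lintegral_comp (by fun_prop),
    lintegral_eq_lintegral_shellDensity_mul (by omega) (by fun_prop),
    ← lintegral_indicator measurableSet_Ioi]
  refine lintegral_congr fun s => ?_
  by_cases hs : s ∈ Set.Ioi 0
  · simp only [Set.indicator_of_mem hs, Pi.mul_apply, mul_comm (∏ _, _)]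
    rw [lintegral_comp_sum_sq_mul_prod_sphereUnif hN hq hf.nonneg hfq F hs, energyDensity,
      ENNReal.ofReal_mul (shellDensity_nonneg s)]
    ring
  · simp [Set.indicator_of_notMem hs, energyDensity_of_nonpos hN (not_lt.1 hs)]

theorem map_sum_sq_pi_velocityLaw (hN : 3 ≤ N) (hq : q = N / (N - 2)) (hf : IsProbDensity f)
    (hfq : MemLp f (ENNReal.ofReal q)) :
    (Measure.pi fun _ : Fin N => velocityLaw f).map (fun x => ∑ j, x j ^ 2)
      = volume.withDensity fun s => ENNReal.ofReal (energyDensity N f s) := by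
  have hff' := hf.integrable.aemeasurable.ae_eq_mk
  rw [velocityLaw_congr_ae hff', map_sum_sq_pi_velocityLaw_of_measurable hN hq (hf.congr_ae hff')
    (hfq.ae_eq hff') hf.integrable.aemeasurable.measurable_mk]
  exact congrArg _ (funext fun s => by rw [energyDensity_congr_ae hN hff'])

/-- The law of the energy `v ^ 2` of one particle whose velocity has density `f`. -/
def energyLaw (f : ℝ → ℝ) : Measure ℝ := (velocityLaw f).map fun v => v ^ 2

theorem IsProbDensity.isProbabilityMeasure_energyLaw (hf : IsProbDensity f) :
    IsProbabilityMeasure (energyLaw f) :=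
  have := hf.isProbabilityMeasure_velocityLaw
  Measure.isProbabilityMeasure_map (by fun_prop)

theorem isProbabilityMeasure_withDensity_energyDensity (hN : 3 ≤ N) (hq : q = N / (N - 2))
    (hf : IsProbDensity f) (hfq : MemLp f (ENNReal.ofReal q)) :
    IsProbabilityMeasure (volume.withDensity fun s => ENNReal.ofReal (energyDensity N f s)) := by
  have := hf.isProbabilityMeasure_velocityLaw
  rw [← map_sum_sq_pi_velocityLaw hN hq hf hfq]
  exact Measure.isProbabilityMeasure_map (Measurable.aemeasurable (by fun_prop))

theorem charFun_withDensity_energyDensity (hN : 3 ≤ N) (hq : q = N / (N - 2))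
    (hf : IsProbDensity f) (hfq : MemLp f (ENNReal.ofReal q)) (t : ℝ) :
    charFun (volume.withDensity fun s => ENNReal.ofReal (energyDensity N f s)) t
      = charFun (energyLaw f) t ^ N := by
  have := hf.isProbabilityMeasure_velocityLaw
  have := hf.isProbabilityMeasure_energyLaw
  have map_sum : (Measure.pi fun _ : Fin N => velocityLaw f).map (fun x => ∑ j, x j ^ 2)
      = (Measure.pi fun _ : Fin N => energyLaw f).map fun x => ∑ j, x j := by
    unfold energyLaw
    rw [← Measure.pi_map_pi (fun _ => by fun_prop), Measure.map_map (by fun_prop) (by fun_prop)]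
    rfl
  rw [← map_sum_sq_pi_velocityLaw hN hq hf hfq, map_sum,
    ProbabilityTheory.charFun_map_sum_pi_eq_prod]
  simp

end EnergyLaw

section CharacteristicFunction

theorem integral_charFun_comm (μ ν : Measure ℝ) [IsFiniteMeasure μ] [IsFiniteMeasure ν] :
    ∫ t, charFun μ t ∂ν = ∫ x, charFun ν x ∂μ := by
  simp only [charFun_apply_real]
  rw [integral_integral_swap]
  · congr with x
    congr with t
    rw [mul_comm (t : ℂ)]
  · refine Integrable.of_bound (C := 1) (by fun_prop) (.of_forall fun z => ?_)
    rw [Function.uncurry, ← Complex.ofReal_mul, Complex.norm_exp_ofReal_mul_I]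

variable {μ ν : Measure ℝ} {B : ℝ≥0∞}

theorem charFun_conv_map_neg (μ : Measure ℝ) [IsFiniteMeasure μ] (t : ℝ) :
    charFun (μ.conv (μ.map (-·))) t = ((‖charFun μ t‖ ^ 2 : ℝ) : ℂ) := by
  have map_neg : charFun (μ.map (-·)) t = charFun μ (-t) := by
    have := charFun_map_mul (μ := μ) (-1) t
    simpa using this
  rw [charFun_conv, map_neg, charFun_neg, RCLike.mul_conj]
  norm_cast

open ProbabilityTheory in
theorem lintegral_gaussianReal_enorm_charFun_sq (μ : Measure ℝ) [IsFiniteMeasure μ] (v : NNReal) :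
    ∫⁻ t, ‖charFun μ t‖ₑ ^ 2 ∂gaussianReal 0 v
      = ∫⁻ x, ∫⁻ y, ENNReal.ofReal (Real.exp (-(v / 2) * (x - y) ^ 2)) ∂μ ∂μ := by
  have := Measure.isFiniteMeasure_map μ fun x => -x
  have parseval : ∫ t, ‖charFun μ t‖ ^ 2 ∂gaussianReal 0 v
      = ∫ z, Real.exp (-(v / 2) * z ^ 2) ∂μ.conv (μ.map (-·)) := by
    have := integral_charFun_comm (μ.conv (μ.map (-·))) (gaussianReal 0 v)
    simp only [charFun_conv_map_neg, charFun_gaussianReal, integral_complex_ofReal] at this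
    rw [← Complex.ofReal_inj, this, ← integral_complex_ofReal]
    congr with z
    push_cast
    ring_nf
  have charFun_sq : Integrable (fun t => ‖charFun μ t‖ ^ 2) (gaussianReal 0 v) :=
    .of_bound (by fun_prop) (μ.real Set.univ ^ 2) (.of_forall fun t => by
      rw [norm_pow, norm_norm]
      exact pow_le_pow_left₀ (norm_nonneg _) (norm_charFun_le t) 2)
  have gaussian : Integrable (fun z : ℝ => Real.exp (-(v / 2) * z ^ 2)) (μ.conv (μ.map (-·))) :=
    .of_bound (by fun_prop) 1 (.of_forall fun z => by
      rw [Real.norm_eq_abs, Real.abs_exp, Real.exp_le_one_iff]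
      exact mul_nonpos_of_nonpos_of_nonneg (by simp [div_nonneg]) (sq_nonneg z))
  calc ∫⁻ t, ‖charFun μ t‖ₑ ^ 2 ∂gaussianReal 0 v
      = ENNReal.ofReal (∫ t, ‖charFun μ t‖ ^ 2 ∂gaussianReal 0 v) := by
        rw [ofReal_integral_eq_lintegral_ofReal charFun_sq (.of_forall fun t => by positivity)]
        simp only [ENNReal.ofReal_pow (norm_nonneg _), ofReal_norm]
    _ = ∫⁻ z, ENNReal.ofReal (Real.exp (-(v / 2) * z ^ 2)) ∂μ.conv (μ.map (-·)) := by
        rw [parseval, ofReal_integral_eq_lintegral_ofReal gaussian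
          (.of_forall fun z => (Real.exp_pos _).le)]
    _ = _ := by
        rw [Measure.lintegral_conv (by fun_prop)]
        refine lintegral_congr fun x => ?_
        rw [lintegral_map (by fun_prop) (by fun_prop)]
        simp only [sub_eq_add_neg]

theorem lintegral_exp_mul_enorm_charFun_sq_le [IsProbabilityMeasure μ] (hμ : μ ≤ B • volume)
    {v : NNReal} (hv : v ≠ 0) :
    ∫⁻ t, ENNReal.ofReal (Real.exp (-t ^ 2 / (2 * v))) * ‖charFun μ t‖ₑ ^ 2
      ≤ ENNReal.ofReal (2 * Real.pi) * B := by
  have : (0 : ℝ) < v := by exact_mod_cast hv.bot_lt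
  have gaussian_fiber : ∀ x, ∫⁻ y, ENNReal.ofReal (Real.exp (-(v / 2) * (x - y) ^ 2)) ∂μ
      ≤ B * ENNReal.ofReal √(2 * Real.pi / v) := fun x => by
    refine (lintegral_mono' hμ le_rfl).trans_eq ?_
    rw [lintegral_smul_measure, smul_eq_mul,
      lintegral_sub_left_eq_self (fun y => ENNReal.ofReal (Real.exp (-(v / 2) * y ^ 2))) x,
      ← ofReal_integral_eq_lintegral_ofReal (integrable_exp_neg_mul_sq (by positivity))
        (.of_forall fun y => (Real.exp_pos _).le), integral_gaussian, div_div_eq_mul_div,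
      mul_comm Real.pi]
  have weight : ∀ t, ENNReal.ofReal (Real.exp (-t ^ 2 / (2 * v)))
      = ENNReal.ofReal √(2 * Real.pi * v) * ProbabilityTheory.gaussianPDF 0 v t := fun t => by
    rw [ProbabilityTheory.gaussianPDF, ProbabilityTheory.gaussianPDFReal, ← ENNReal.ofReal_mul
      (Real.sqrt_nonneg _), mul_inv_cancel_left₀ (by positivity), sub_zero]
  have gauss := lintegral_gaussianReal_enorm_charFun_sq μ v
  rw [ProbabilityTheory.gaussianReal_of_var_ne_zero 0 hv, lintegral_withDensity_eq_lintegral_mul _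
    (ProbabilityTheory.measurable_gaussianPDF 0 v) (by fun_prop)] at gauss
  simp only [Pi.mul_apply] at gauss
  simp_rw [weight, mul_assoc (ENNReal.ofReal _)]
  rw [lintegral_const_mul _ (by fun_prop), gauss]
  calc _ ≤ ENNReal.ofReal √(2 * Real.pi * v) * ∫⁻ _, B * ENNReal.ofReal √(2 * Real.pi / v) ∂μ := by
        gcongr
        exact gaussian_fiber _
    _ = B * ENNReal.ofReal (√(2 * Real.pi * v) * √(2 * Real.pi / v)) := by
        rw [lintegral_const, measure_univ, mul_one, ENNReal.ofReal_mul (Real.sqrt_nonneg _)]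
        ring
    _ = _ := by
        rw [← Real.sqrt_mul (by positivity), mul_comm B, show
          2 * Real.pi * v * (2 * Real.pi / v) = (2 * Real.pi) ^ 2 by field_simp,
          Real.sqrt_sq (by positivity)]

theorem lintegral_enorm_charFun_sq_le [IsProbabilityMeasure μ] (hμ : μ ≤ B • volume) :
    ∫⁻ t, ‖charFun μ t‖ₑ ^ 2 ≤ ENNReal.ofReal (2 * Real.pi) * B := by
  have weight_tendsto : ∀ t : ℝ, Tendsto (fun n : ℕ =>
      ENNReal.ofReal (Real.exp (-t ^ 2 / (2 * (n + 1 : NNReal)))) * ‖charFun μ t‖ₑ ^ 2) atTop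
      (𝓝 (‖charFun μ t‖ₑ ^ 2)) := by
    intro t
    have exponent : Tendsto (fun n : ℕ => -t ^ 2 / (2 * ((n : ℝ) + 1))) atTop (𝓝 0) :=
      tendsto_const_nhds.div_atTop ((tendsto_natCast_atTop_atTop.atTop_add
        tendsto_const_nhds).const_mul_atTop two_pos)
    have weight := ENNReal.tendsto_ofReal (Real.continuous_exp.continuousAt.tendsto.comp exponent)
    rw [Real.exp_zero, ENNReal.ofReal_one] at weight
    simpa using ENNReal.Tendsto.mul_const weight (.inl one_ne_zero)
  calc ∫⁻ t, ‖charFun μ t‖ₑ ^ 2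
      = ∫⁻ t, liminf (fun n : ℕ =>
          ENNReal.ofReal (Real.exp (-t ^ 2 / (2 * (n + 1 : NNReal)))) * ‖charFun μ t‖ₑ ^ 2)
            atTop := by
        simp only [(weight_tendsto _).liminf_eq]
    _ ≤ _ := lintegral_liminf_le fun n => by fun_prop
    _ ≤ _ := liminf_le_of_le (by isBoundedDefault) fun b hb => by
        obtain ⟨n, hn⟩ := hb.exists
        exact hn.trans (lintegral_exp_mul_enorm_charFun_sq_le hμ (by positivity))

variable {g h : ℝ → ℝ}

theorem integrable_of_isFiniteMeasure_withDensity (hg : Continuous g) (hg0 : ∀ x, 0 ≤ g x)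
    [IsFiniteMeasure (volume.withDensity fun x => ENNReal.ofReal (g x))] : Integrable g := by
  rw [← lintegral_ofReal_ne_top_iff_integrable hg.aestronglyMeasurable (.of_forall hg0),
    ← setLIntegral_univ, ← withDensity_apply _ .univ]
  exact measure_ne_top _ _

open FourierTransform in
theorem fourier_eq_charFun_withDensity (hg : Continuous g) (hg0 : ∀ x, 0 ≤ g x) (w : ℝ) :
    𝓕 (fun x => (g x : ℂ)) w
      = charFun (volume.withDensity fun x => ENNReal.ofReal (g x)) (-(2 * Real.pi) * w) := by
  rw [charFun_apply_real, integral_withDensity_eq_integral_toReal_smul (by fun_prop) (by simp),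
    Real.fourier_real_eq_integral_exp_smul]
  congr with x
  rw [ENNReal.toReal_ofReal (hg0 x), Complex.real_smul, smul_eq_mul, mul_comm]
  push_cast
  ring_nf

theorem charFun_withDensity_inversion (hg : Continuous g) (hg0 : ∀ x, 0 ≤ g x)
    [IsFiniteMeasure (volume.withDensity fun x => ENNReal.ofReal (g x))]
    (hφ : Integrable (charFun (volume.withDensity fun x => ENNReal.ofReal (g x)))) (y : ℝ) :
    (g y : ℂ) = (2 * Real.pi : ℝ)⁻¹ • ∫ t : ℝ, Complex.exp (-(t * y) * Complex.I) *
      charFun (volume.withDensity fun x => ENNReal.ofReal (g x)) t := by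
  have hg_int := integrable_of_isFiniteMeasure_withDensity hg hg0
  have fourier_eq := funext (fourier_eq_charFun_withDensity hg hg0)
  have inversion := congrFun (Continuous.fourierInv_fourier_eq
    (Complex.continuous_ofReal.comp hg) hg_int.ofReal
    (fourier_eq ▸ hφ.comp_mul_left' (neg_ne_zero.2 Real.two_pi_pos.ne'))) y
  rw [Function.comp_def, fourier_eq, Real.fourierInv_eq'] at inversion
  have substitution := Measure.integral_comp_mul_left (fun t : ℝ => Complex.exp (-(t * y) *
    Complex.I) * charFun (volume.withDensity fun x => ENNReal.ofReal (g x)) t) (-(2 * Real.pi))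
  rw [abs_inv, abs_neg, abs_of_pos Real.two_pi_pos] at substitution
  rw [← substitution]
  refine inversion.symm.trans ?_
  congr with w
  rw [smul_eq_mul, RCLike.inner_apply, conj_trivial]
  push_cast
  ring_nf

theorem abs_sub_le_integral_norm_charFun_sub (hg : Continuous g) (hg0 : ∀ x, 0 ≤ g x)
    (hh : Continuous h) (hh0 : ∀ x, 0 ≤ h x)
    [IsFiniteMeasure (volume.withDensity fun x => ENNReal.ofReal (g x))]
    [IsFiniteMeasure (volume.withDensity fun x => ENNReal.ofReal (h x))]
    (hgφ : Integrable (charFun (volume.withDensity fun x => ENNReal.ofReal (g x))))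
    (hhφ : Integrable (charFun (volume.withDensity fun x => ENNReal.ofReal (h x)))) (y : ℝ) :
    |g y - h y| ≤ (2 * Real.pi)⁻¹ *
      ∫ t, ‖charFun (volume.withDensity fun x => ENNReal.ofReal (g x)) t
        - charFun (volume.withDensity fun x => ENNReal.ofReal (h x)) t‖ := by
  have norm_exp : ∀ t : ℝ, ‖Complex.exp (-(t * y) * Complex.I)‖ = 1 := fun t => by
    rw [← Complex.ofReal_mul, ← Complex.ofReal_neg, Complex.norm_exp_ofReal_mul_I]
  have integrable_mul : ∀ {φ : ℝ → ℂ}, Integrable φ →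
      Integrable fun t : ℝ => Complex.exp (-(t * y) * Complex.I) * φ t := fun hφ =>
    hφ.bdd_mul (c := 1) (by fun_prop) (.of_forall fun t => (norm_exp t).le)
  rw [← Real.norm_eq_abs, ← Complex.norm_real, Complex.ofReal_sub,
    charFun_withDensity_inversion hg hg0 hgφ y, charFun_withDensity_inversion hh hh0 hhφ y,
    ← smul_sub, ← integral_sub (integrable_mul hgφ) (integrable_mul hhφ), norm_smul, norm_inv,
    Real.norm_of_nonneg (by positivity)]
  gcongr
  refine (norm_integral_le_integral_norm _).trans_eq ?_
  simp only [← mul_sub, norm_mul, norm_exp, one_mul]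

end CharacteristicFunction

section Cramer

variable {μ : Measure ℝ}

theorem abs_sin_nat_mul_le (n : ℕ) (x : ℝ) : |Real.sin (n * x)| ≤ n * |Real.sin x| := by
  induction n with
  | zero => simp
  | succ n ih =>
    push_cast
    rw [add_mul, one_mul, Real.sin_add]
    calc |Real.sin (n * x) * Real.cos x + Real.cos (n * x) * Real.sin x|
        ≤ |Real.sin (n * x)| * |Real.cos x| + |Real.cos (n * x)| * |Real.sin x| := by
          simpa only [abs_mul] using
            abs_add_le (Real.sin (n * x) * Real.cos x) (Real.cos (n * x) * Real.sin x)
      _ ≤ |Real.sin (n * x)| * 1 + 1 * |Real.sin x| := by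
          gcongr <;> exact Real.abs_cos_le_one _
      _ ≤ (n + 1) * |Real.sin x| := by linarith

theorem one_sub_cos_nat_mul_le (n : ℕ) (x : ℝ) :
    1 - Real.cos (n * x) ≤ n ^ 2 * (1 - Real.cos x) := by
  have one_sub_cos (y : ℝ) : 1 - Real.cos y = 2 * |Real.sin (y / 2)| ^ 2 := by
    rw [sq_abs, Real.sin_sq_eq_half_sub, mul_div_cancel₀ _ two_ne_zero]; ring
  rw [one_sub_cos, one_sub_cos, mul_div_assoc]
  calc 2 * |Real.sin (n * (x / 2))| ^ 2 ≤ 2 * (n * |Real.sin (x / 2)|) ^ 2 := by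
        gcongr; exact abs_sin_nat_mul_le n _
    _ = n ^ 2 * (2 * |Real.sin (x / 2)| ^ 2) := by ring

theorem integrable_exp_mul_mul_I [IsFiniteMeasure μ] (t : ℝ) :
    Integrable (fun x : ℝ => Complex.exp (t * x * Complex.I)) μ :=
  Integrable.of_bound (C := 1) (by fun_prop) (.of_forall fun x => by
    rw [← Complex.ofReal_mul, Complex.norm_exp_ofReal_mul_I])

theorem re_exp_neg_mul_I_mul_charFun [IsFiniteMeasure μ] (t θ : ℝ) :
    (Complex.exp (-(θ * Complex.I)) * charFun μ t).re = ∫ x, Real.cos (t * x - θ) ∂μ := by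
  rw [charFun_apply_real, ← integral_const_mul, ← Complex.reCLM_apply,
    ← ContinuousLinearMap.integral_comp_comm _ ((integrable_exp_mul_mul_I t).const_mul _)]
  congr with x
  rw [← Complex.exp_add, Complex.reCLM_apply, ← Complex.exp_ofReal_mul_I_re]
  congr 2
  push_cast
  ring

theorem norm_charFun_eq_integral_cos [IsFiniteMeasure μ] (t : ℝ) :
    ‖charFun μ t‖ = ∫ x, Real.cos (t * x - (charFun μ t).arg) ∂μ := by
  rw [← re_exp_neg_mul_I_mul_charFun]
  nth_rw 3 [← Complex.norm_mul_exp_arg_mul_I (charFun μ t)]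
  rw [mul_left_comm, ← Complex.exp_add, neg_add_cancel, Complex.exp_zero, mul_one,
    Complex.ofReal_re]

theorem integral_cos_le_norm_charFun [IsFiniteMeasure μ] (t θ : ℝ) :
    ∫ x, Real.cos (t * x - θ) ∂μ ≤ ‖charFun μ t‖ := by
  rw [← re_exp_neg_mul_I_mul_charFun]
  refine (Complex.re_le_norm _).trans_eq ?_
  rw [norm_mul, ← neg_mul, ← Complex.ofReal_neg, Complex.norm_exp_ofReal_mul_I, one_mul]

theorem one_sub_sq_mul_le_norm_charFun_nat_mul [IsProbabilityMeasure μ] (n : ℕ) (t : ℝ) :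
    1 - n ^ 2 * (1 - ‖charFun μ t‖) ≤ ‖charFun μ (n * t)‖ := by
  set θ := (charFun μ t).arg
  have integrable_cos (a b : ℝ) : Integrable (fun x => Real.cos (a * x - b)) μ :=
    Integrable.of_bound (C := 1) (by fun_prop) (.of_forall fun x => Real.abs_cos_le_one _)
  have integrable_one_sub : Integrable (fun x => 1 - Real.cos (t * x - θ)) μ :=
    (integrable_const _).sub (integrable_cos _ _)
  calc 1 - (n : ℝ) ^ 2 * (1 - ‖charFun μ t‖)
      = ∫ x, 1 - (n : ℝ) ^ 2 * (1 - Real.cos (t * x - θ)) ∂μ := by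
        rw [norm_charFun_eq_integral_cos, integral_sub (integrable_const _)
          (integrable_one_sub.const_mul _), integral_const_mul,
          integral_sub (integrable_const _) (integrable_cos _ _)]
        simp only [integral_const, probReal_univ, smul_eq_mul, mul_one, θ]
    _ ≤ ∫ x, Real.cos (n * t * x - n * θ) ∂μ := by
        refine integral_mono ((integrable_const _).sub (integrable_one_sub.const_mul _))
          (integrable_cos _ _) fun x => ?_
        have := one_sub_cos_nat_mul_le n (t * x - θ)
        rw [mul_sub, ← mul_assoc] at this
        linarith
    _ ≤ ‖charFun μ (n * t)‖ := integral_cos_le_norm_charFun _ _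

theorem norm_charFun_sub_charFun_le [IsFiniteMeasure μ] (hμ : Integrable (fun x => x) μ)
    (s t : ℝ) : ‖charFun μ s - charFun μ t‖ ≤ |s - t| * ∫ x, |x| ∂μ := by
  rw [charFun_apply_real, charFun_apply_real, ← integral_sub
    (integrable_exp_mul_mul_I s) (integrable_exp_mul_mul_I t), ← integral_const_mul]
  refine norm_integral_le_of_norm_le (hμ.abs.const_mul _) (.of_forall fun x => ?_)
  have factor : Complex.exp (s * x * Complex.I) - Complex.exp (t * x * Complex.I)
      = Complex.exp ((t * x : ℝ) * Complex.I)
        * (Complex.exp (Complex.I * ((s - t) * x : ℝ)) - 1) := by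
    rw [mul_sub, ← Complex.exp_add, mul_one]
    congr 2 <;> push_cast <;> ring
  rw [factor, norm_mul, Complex.norm_exp_ofReal_mul_I, one_mul, ← abs_mul]
  exact Real.norm_exp_I_mul_ofReal_sub_one_le

theorem half_le_norm_charFun_of_mem_ball [IsProbabilityMeasure μ]
    (hμ : Integrable (fun x => x) μ) (hμ1 : ∫ x, |x| ∂μ ≤ 1) {n K : ℕ} (hK : K ≠ 0) (hn : n ≤ K)
    {s t : ℝ} (ht : 1 - 1 / (4 * K ^ 2) ≤ ‖charFun μ t‖) (hs : s ∈ Metric.ball (n * t) (1 / 4)) :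
    1 / 2 ≤ ‖charFun μ s‖ := by
  have multiple : 3 / 4 ≤ ‖charFun μ (n * t)‖ := by
    have : (n : ℝ) ^ 2 * (1 - ‖charFun μ t‖) ≤ 1 / 4 := by
      calc (n : ℝ) ^ 2 * (1 - ‖charFun μ t‖) ≤ (K : ℝ) ^ 2 * (1 / (4 * K ^ 2)) := by
            gcongr
            · linarith [norm_charFun_le_one (μ := μ) t]
            · linarith
        _ = 1 / 4 := by field_simp
    linarith [one_sub_sq_mul_le_norm_charFun_nat_mul (μ := μ) n t]
  have nearby : ‖charFun μ (n * t) - charFun μ s‖ ≤ 1 / 4 := by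
    rw [Metric.mem_ball, dist_comm, Real.dist_eq] at hs
    calc ‖charFun μ (n * t) - charFun μ s‖ ≤ |n * t - s| * ∫ x, |x| ∂μ :=
          norm_charFun_sub_charFun_le hμ _ _
      _ ≤ 1 / 4 * 1 := by gcongr
      _ = 1 / 4 := mul_one _
  linarith [norm_sub_norm_le (charFun μ (n * t)) (charFun μ s)]

theorem volume_biUnion_ball_nat_mul {a t : ℝ} (ha : 0 ≤ a) (hat : 2 * a ≤ |t|) (K : ℕ) :
    volume (⋃ n ∈ Finset.Icc 1 K, Metric.ball ((n : ℝ) * t) a)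
      = ENNReal.ofReal (K * (2 * a)) := by
  have disjoint : Set.PairwiseDisjoint (↑(Finset.Icc 1 K))
      fun n : ℕ => Metric.ball ((n : ℝ) * t) a := by
    intro k _ l _ hkl
    refine Metric.ball_disjoint_ball ?_
    rw [Real.dist_eq, ← sub_mul, abs_mul]
    have : (1 : ℝ) ≤ |(k : ℝ) - l| := by
      exact_mod_cast Int.one_le_abs (sub_ne_zero.2 (Nat.cast_injective.ne hkl : (k : ℤ) ≠ l))
    nlinarith [abs_nonneg t]
  rw [measure_biUnion_finset disjoint fun _ _ => Metric.isOpen_ball.measurableSet]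
  simp only [Real.volume_ball, Finset.sum_const, Nat.card_Icc, Nat.add_sub_cancel]
  rw [nsmul_eq_mul, ENNReal.ofReal_mul K.cast_nonneg, ENNReal.ofReal_natCast]

/- If `|φ(t)|` is close to `1`, so are `|φ(t)|, |φ(2t)|, …, |φ(Kt)|`, and `φ` is large near each
of these `K` separated points. -/
theorem le_lintegral_enorm_charFun_pow [IsProbabilityMeasure μ]
    (hμ : Integrable (fun x => x) μ) (hμ1 : ∫ x, |x| ∂μ ≤ 1) {K : ℕ} (hK : K ≠ 0) {a t : ℝ}
    (ha : 0 ≤ a) (ha4 : a ≤ 1 / 4) (hat : 2 * a ≤ |t|)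
    (ht : 1 - 1 / (4 * K ^ 2) ≤ ‖charFun μ t‖) (m : ℕ) :
    ENNReal.ofReal ((1 / 2) ^ m * (K * (2 * a))) ≤ ∫⁻ s, ‖charFun μ s‖ₑ ^ m := by
  set U := ⋃ n ∈ Finset.Icc 1 K, Metric.ball ((n : ℝ) * t) a
  calc ENNReal.ofReal ((1 / 2) ^ m * (K * (2 * a)))
      = ∫⁻ _ in U, ENNReal.ofReal ((1 / 2) ^ m) := by
        rw [setLIntegral_const, volume_biUnion_ball_nat_mul ha hat,
          ENNReal.ofReal_mul (by positivity)]
    _ ≤ ∫⁻ s in U, ‖charFun μ s‖ₑ ^ m := by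
        refine setLIntegral_mono' ((Finset.Icc 1 K).measurableSet_biUnion
          fun _ _ => Metric.isOpen_ball.measurableSet) fun s hs => ?_
        obtain ⟨n, hn, hs⟩ := Set.mem_iUnion₂.1 hs
        rw [← ofReal_norm, ← ENNReal.ofReal_pow (norm_nonneg _)]
        gcongr
        exact half_le_norm_charFun_of_mem_ball hμ hμ1 hK (Finset.mem_Icc.1 hn).2 ht
          (Metric.ball_subset_ball ha4 hs)
    _ ≤ ∫⁻ s, ‖charFun μ s‖ₑ ^ m := setLIntegral_le_lintegral _ _

theorem exists_norm_charFun_le (m : ℕ) (A : NNReal) {δ : ℝ} (hδ : 0 < δ) :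
    ∃ κ : ℝ, 0 < κ ∧ κ < 1 ∧ ∀ μ : Measure ℝ, IsProbabilityMeasure μ →
      Integrable (fun x => x) μ → ∫ x, |x| ∂μ ≤ 1 → ∫⁻ t, ‖charFun μ t‖ₑ ^ m ≤ A →
      ∀ t, δ ≤ |t| → ‖charFun μ t‖ ≤ κ := by
  set a : ℝ := min (δ / 2) (1 / 4)
  have a_pos : 0 < a := by positivity
  obtain ⟨K, hK⟩ := exists_nat_gt (max 1 (A / ((1 / 2) ^ m * (2 * a))))
  obtain ⟨K_gt_one, hK⟩ := max_lt_iff.1 hK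
  have sq_gt : 1 < (K : ℝ) ^ 2 := one_lt_pow₀ K_gt_one two_ne_zero
  have defect_pos : 0 < 1 / (4 * (K : ℝ) ^ 2) := by positivity
  have defect_lt : 1 / (4 * (K : ℝ) ^ 2) < 1 := by
    rw [div_lt_one (by positivity)]; linarith
  refine ⟨1 - 1 / (4 * K ^ 2), by linarith, by linarith, fun μ _ hμ hμ1 hA t ht => ?_⟩
  by_contra! hlt
  have lower := (le_lintegral_enorm_charFun_pow hμ hμ1 (by rintro rfl; norm_num at K_gt_one)
    a_pos.le (min_le_right _ _) (by linarith [min_le_left (δ / 2) (1 / 4 : ℝ)]) hlt.le m).trans hA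
  rw [div_lt_iff₀ (by positivity)] at hK
  rw [← ENNReal.ofReal_coe_nnreal, ENNReal.ofReal_le_ofReal_iff A.coe_nonneg] at lower
  linarith

end Cramer

section TaylorExpansion

theorem norm_exp_mul_I_sub_taylor_le (x : ℝ) :
    ‖Complex.exp (x * Complex.I) - (1 + x * Complex.I - x ^ 2 / 2)‖ ≤ 4 * min 1 |x| * x ^ 2 := by
  have norm_mul_I : ‖(x : ℂ) * Complex.I‖ = |x| := by simp
  rcases le_or_gt |x| 1 with hx | hx
  · have taylor := Complex.exp_bound (norm_mul_I.trans_le hx) (n := 3) (by norm_num)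
    have sum_eq : ∑ j ∈ Finset.range 3, ((x : ℂ) * Complex.I) ^ j / (j.factorial : ℂ)
        = 1 + x * Complex.I - x ^ 2 / 2 := by
      simp only [Finset.sum_range_succ, Finset.sum_range_zero, Nat.factorial]
      push_cast
      rw [mul_pow (x : ℂ) Complex.I 2, Complex.I_sq]
      ring
    rw [sum_eq, norm_mul_I] at taylor
    rw [min_eq_right hx]
    refine taylor.trans ?_
    norm_num [Nat.factorial]
    rw [← sq_abs x]
    linarith [pow_nonneg (abs_nonneg x) 3, show 4 * |x| * |x| ^ 2 = 4 * |x| ^ 3 by ring]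
  · have norm_sq_div : ‖(x : ℂ) ^ 2 / 2‖ = |x| ^ 2 / 2 := by
      rw [norm_div, norm_pow, Complex.norm_real, Real.norm_eq_abs, Complex.norm_two]
    calc ‖Complex.exp (x * Complex.I) - (1 + x * Complex.I - x ^ 2 / 2)‖
        ≤ ‖Complex.exp (x * Complex.I)‖
          + (‖(1 : ℂ)‖ + ‖(x : ℂ) * Complex.I‖ + ‖(x : ℂ) ^ 2 / 2‖) :=
          (norm_sub_le _ _).trans <| by
            gcongr; exact (norm_sub_le _ _).trans <| by gcongr; exact norm_add_le _ _
      _ = 1 + (1 + |x| + |x| ^ 2 / 2) := by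
          rw [Complex.norm_exp_ofReal_mul_I, norm_one, norm_mul_I, norm_sq_div]
      _ ≤ 4 * min 1 |x| * x ^ 2 := by
          rw [min_eq_left hx.le, ← sq_abs x]; nlinarith

variable {μ : Measure ℝ} [IsProbabilityMeasure μ]

theorem charFun_sub_taylor_eq_integral (hμ : Integrable (fun x => x) μ)
    (hμ2 : Integrable (fun x => x ^ 2) μ) (mean : ∫ x, x ∂μ = 0) (variance : ∫ x, x ^ 2 ∂μ = 1)
    (t : ℝ) :
    charFun μ t - (1 - t ^ 2 / 2 : ℝ) = ∫ x : ℝ, (Complex.exp (t * x * Complex.I)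
      - (1 + t * x * Complex.I - (t * x) ^ 2 / 2)) ∂μ := by
  have integrable_linear : Integrable (fun x : ℝ => (t * x * Complex.I : ℂ)) μ :=
    (hμ.ofReal.const_mul _).mul_const _
  have integrable_quadratic : Integrable (fun x : ℝ => ((t * x) ^ 2 / 2 : ℂ)) μ := by
    refine (hμ2.ofReal.const_mul (t ^ 2 / 2 : ℂ)).congr (.of_forall fun x => ?_)
    simp only [Complex.coe_algebraMap, Complex.ofReal_pow]
    ring
  have integral_linear : ∫ x : ℝ, (t * x * Complex.I : ℂ) ∂μ = 0 := by
    rw [integral_mul_const, integral_const_mul, integral_complex_ofReal, mean]; simp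
  have integral_quadratic : ∫ x : ℝ, ((t * x) ^ 2 / 2 : ℂ) ∂μ = (t ^ 2 / 2 : ℝ) := by
    simp only [mul_pow, ← Complex.ofReal_pow]
    rw [integral_div, integral_const_mul, integral_complex_ofReal, variance]
    push_cast
    ring
  have integrable_affine : Integrable (fun x : ℝ => (1 + t * x * Complex.I : ℂ)) μ :=
    (integrable_const _).add integrable_linear
  rw [charFun_apply_real, integral_sub (integrable_exp_mul_mul_I t), integral_sub,
    integral_add (integrable_const _), integral_linear, integral_quadratic]
  all_goals first | assumption | skip
  · simp
  · exact integrable_affine.sub integrable_quadratic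

theorem norm_charFun_sub_taylor_le {R : ℝ} (hR : 0 ≤ R) (hμ : Integrable (fun x => x) μ)
    (hμ2 : Integrable (fun x => x ^ 2) μ) (mean : ∫ x, x ∂μ = 0) (variance : ∫ x, x ^ 2 ∂μ = 1)
    (t : ℝ) :
    ‖charFun μ t - (1 - t ^ 2 / 2 : ℝ)‖
      ≤ 4 * t ^ 2 * (|t| * R + ∫ x in {x | R ≤ |x|}, x ^ 2 ∂μ) := by
  set S := {x : ℝ | R ≤ |x|}
  have hS : MeasurableSet S := measurableSet_le measurable_const (by fun_prop)
  have pointwise (x : ℝ) : ‖Complex.exp (t * x * Complex.I)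
      - (1 + t * x * Complex.I - (t * x) ^ 2 / 2)‖
      ≤ 4 * t ^ 2 * (|t| * R * x ^ 2 + S.indicator (fun x => x ^ 2) x) := by
    have taylor := norm_exp_mul_I_sub_taylor_le (t * x)
    push_cast at taylor
    refine taylor.trans ?_
    rw [mul_pow, show ∀ c : ℝ, 4 * c * (t ^ 2 * x ^ 2) = 4 * t ^ 2 * (c * x ^ 2) by intro c; ring]
    gcongr
    by_cases hx : x ∈ S
    · rw [Set.indicator_of_mem hx]
      nlinarith [min_le_left 1 |t * x|, sq_nonneg x, show 0 ≤ |t| * R * x ^ 2 by positivity]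
    · rw [Set.indicator_of_notMem hx, add_zero]
      gcongr
      refine (min_le_right _ _).trans ?_
      rw [abs_mul]
      gcongr
      exact (not_le.1 hx).le
  have integrable_R := hμ2.const_mul (|t| * R)
  rw [charFun_sub_taylor_eq_integral hμ hμ2 mean variance]
  refine (norm_integral_le_of_norm_le ((integrable_R.add (hμ2.indicator hS)).const_mul _)
    (.of_forall pointwise)).trans_eq ?_
  rw [integral_const_mul, integral_add' integrable_R (hμ2.indicator hS), integral_const_mul,
    integral_indicator hS, variance, mul_one]

theorem norm_pow_sub_pow_le_mul {a b : ℂ} {ρ : ℝ} (ha : ‖a‖ ≤ ρ) (hb : ‖b‖ ≤ ρ) (n : ℕ) :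
    ‖a ^ n - b ^ n‖ ≤ n * ‖a - b‖ * ρ ^ (n - 1) := by
  have hρ : 0 ≤ ρ := (norm_nonneg a).trans ha
  rw [← (Commute.all a b).geom_sum₂_mul, norm_mul, mul_right_comm]
  gcongr
  calc ‖∑ i ∈ Finset.range n, a ^ i * b ^ (n - 1 - i)‖
      ≤ ∑ i ∈ Finset.range n, ‖a ^ i * b ^ (n - 1 - i)‖ := norm_sum_le _ _
    _ ≤ ∑ _i ∈ Finset.range n, ρ ^ (n - 1) := by
        refine Finset.sum_le_sum fun i hi => ?_
        rw [norm_mul, norm_pow, norm_pow]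
        calc ‖a‖ ^ i * ‖b‖ ^ (n - 1 - i) ≤ ρ ^ i * ρ ^ (n - 1 - i) := by gcongr
          _ = ρ ^ (n - 1) := by
            rw [← pow_add, Nat.add_sub_cancel' (by have := Finset.mem_range.1 hi; omega)]
    _ = n * ρ ^ (n - 1) := by rw [Finset.sum_const, Finset.card_range, nsmul_eq_mul]

theorem mul_exp_neg_div_eight_le (y : ℝ) :
    y * Real.exp (-(y / 8)) ≤ 16 * Real.exp (-(y / 16)) := by
  have : y / 16 * Real.exp (-(y / 16)) ≤ 1 := by
    rw [Real.exp_neg, ← div_eq_mul_inv, div_le_one (Real.exp_pos _)]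
    linarith [Real.add_one_le_exp (y / 16)]
  calc y * Real.exp (-(y / 8)) = 16 * (y / 16 * Real.exp (-(y / 16))) * Real.exp (-(y / 16)) := by
        rw [mul_assoc, mul_assoc, ← Real.exp_add]; ring_nf
    _ ≤ 16 * 1 * Real.exp (-(y / 16)) := by gcongr
    _ = 16 * Real.exp (-(y / 16)) := by ring

theorem norm_pow_sub_exp_le {a : ℂ} {s ε : ℝ} {n : ℕ} (hn : 2 ≤ n) (hε : ε ≤ 1 / 4)
    (hs : s ^ 2 ≤ 4 * ε) (ha : ‖a - (1 - s ^ 2 / 2 : ℝ)‖ ≤ ε * s ^ 2) :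
    ‖a ^ n - (Real.exp (-(n * s ^ 2 / 2)) : ℝ)‖ ≤ 32 * ε * Real.exp (-(n * s ^ 2 / 16)) := by
  set b : ℂ := ((Real.exp (-(s ^ 2 / 2)) : ℝ) : ℂ)
  have two_le : (2 : ℝ) ≤ n := by exact_mod_cast hn
  have hε0 : 0 ≤ ε := by linarith [sq_nonneg s]
  have b_pow : ((Real.exp (-(n * s ^ 2 / 2)) : ℝ) : ℂ) = b ^ n := by
    rw [← Complex.ofReal_pow, ← Real.exp_nat_mul]; ring_nf
  have norm_sub : ‖a - b‖ ≤ 2 * ε * s ^ 2 := by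
    have := Real.abs_exp_sub_one_sub_id_le (x := -(s ^ 2 / 2)) (by
      rw [abs_neg, abs_of_nonneg (by positivity)]; linarith)
    calc ‖a - b‖ ≤ ‖a - (1 - s ^ 2 / 2 : ℝ)‖ + ‖((1 - s ^ 2 / 2 : ℝ) : ℂ) - b‖ :=
          norm_sub_le_norm_sub_add_norm_sub _ _ _
      _ ≤ ε * s ^ 2 + (s ^ 2 / 2) ^ 2 := by
          gcongr
          rw [← Complex.ofReal_sub, Complex.norm_real, Real.norm_eq_abs, abs_sub_comm]
          rwa [neg_sq, sub_sub, ← sub_eq_add_neg] at this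
      _ ≤ 2 * ε * s ^ 2 := by nlinarith [sq_nonneg s]
  have norm_a : ‖a‖ ≤ Real.exp (-(s ^ 2 / 4)) := by
    have := norm_sub_norm_le a (1 - s ^ 2 / 2 : ℝ)
    rw [Complex.norm_real, Real.norm_of_nonneg (by linarith)] at this
    nlinarith [Real.add_one_le_exp (-(s ^ 2 / 4)), sq_nonneg s]
  have norm_b : ‖b‖ ≤ Real.exp (-(s ^ 2 / 4)) := by
    rw [Complex.norm_real, Real.norm_of_nonneg (Real.exp_pos _).le]
    exact Real.exp_le_exp.2 (by linarith [sq_nonneg s])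
  rw [b_pow]
  calc ‖a ^ n - b ^ n‖ ≤ n * ‖a - b‖ * Real.exp (-(s ^ 2 / 4)) ^ (n - 1) :=
        norm_pow_sub_pow_le_mul norm_a norm_b n
    _ ≤ n * (2 * ε * s ^ 2) * Real.exp (-(n * s ^ 2 / 8)) := by
        gcongr
        rw [← Real.exp_nat_mul, Nat.cast_sub (by omega), Nat.cast_one]
        exact Real.exp_le_exp.2 (by nlinarith [sq_nonneg s])
    _ = 2 * ε * (n * s ^ 2 * Real.exp (-(n * s ^ 2 / 8))) := by ring
    _ ≤ 2 * ε * (16 * Real.exp (-(n * s ^ 2 / 16))) := by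
        gcongr _ * ?_; exact mul_exp_neg_div_eight_le _
    _ = 32 * ε * Real.exp (-(n * s ^ 2 / 16)) := by ring

theorem norm_pow_sub_exp_le_of_norm_le {a : ℂ} {s δ κ : ℝ} {m n : ℕ} (hn : n ≠ 0) (hmn : m ≤ n)
    (hδ : 0 < δ) (hs : δ ≤ |s|) (ha : ‖a‖ ≤ κ) :
    ‖a ^ n - (Real.exp (-(n * s ^ 2 / 2)) : ℝ)‖
      ≤ 16 / (δ ^ 2 * n) * Real.exp (-(n * s ^ 2 / 16)) + κ ^ (n - m) * ‖a‖ ^ m := by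
  have exp_le : Real.exp (-(n * s ^ 2 / 2))
      ≤ 16 / (δ ^ 2 * n) * Real.exp (-(n * s ^ 2 / 16)) := by
    have sq_le : δ ^ 2 ≤ s ^ 2 := by rw [← sq_abs s]; gcongr
    rw [div_mul_eq_mul_div, le_div_iff₀ (by positivity), mul_comm]
    calc δ ^ 2 * n * Real.exp (-(n * s ^ 2 / 2))
        ≤ n * s ^ 2 * Real.exp (-(n * s ^ 2 / 8)) := by
          rw [mul_comm (δ ^ 2)]
          gcongr ?_ * Real.exp ?_
          · gcongr
          · linarith [show 0 ≤ n * s ^ 2 by positivity]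
      _ ≤ 16 * Real.exp (-(n * s ^ 2 / 16)) := mul_exp_neg_div_eight_le _
  calc ‖a ^ n - (Real.exp (-(n * s ^ 2 / 2)) : ℝ)‖
      ≤ Real.exp (-(n * s ^ 2 / 2)) + ‖a‖ ^ n := by
        refine (norm_sub_le _ _).trans_eq ?_
        rw [norm_pow, Complex.norm_real, Real.norm_of_nonneg (Real.exp_pos _).le, add_comm]
    _ ≤ 16 / (δ ^ 2 * n) * Real.exp (-(n * s ^ 2 / 16)) + κ ^ (n - m) * ‖a‖ ^ m := by
        rw [← pow_sub_mul_pow ‖a‖ hmn]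
        gcongr

end TaylorExpansion

section UniformCLT

/-- A family of standardized probability measures on `ℝ` along which the central limit theorem
holds uniformly, even at the level of densities: the second moments are uniformly integrable, and
the `m`-th powers of the characteristic functions are bounded in `L¹` by `A`. -/
structure IsUniformCLTFamily (m : ℕ) (A : NNReal) (𝒦 : Set (Measure ℝ)) : Prop where
  isProbabilityMeasure : ∀ μ ∈ 𝒦, IsProbabilityMeasure μ
  integrable_sq : ∀ μ ∈ 𝒦, Integrable (fun x => x ^ 2) μ
  mean : ∀ μ ∈ 𝒦, ∫ x, x ∂μ = 0
  variance : ∀ μ ∈ 𝒦, ∫ x, x ^ 2 ∂μ = 1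
  exists_tail_le : ∀ ε > 0, ∃ R ≥ 0, ∀ μ ∈ 𝒦, ∫ x in {x | R ≤ |x|}, x ^ 2 ∂μ ≤ ε
  lintegral_charFun_pow_le : ∀ μ ∈ 𝒦, ∫⁻ t, ‖charFun μ t‖ₑ ^ m ≤ A

theorem integrable_id_of_integrable_sq {μ : Measure ℝ} [IsFiniteMeasure μ]
    (hμ : Integrable (fun x => x ^ 2) μ) : Integrable (fun x => x) μ :=
  ((memLp_two_iff_integrable_sq aestronglyMeasurable_id).2 hμ).integrable one_le_two

theorem integral_abs_le_one {μ : Measure ℝ} [IsProbabilityMeasure μ]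
    (hμ : Integrable (fun x => x ^ 2) μ) (variance : ∫ x, x ^ 2 ∂μ = 1) : ∫ x, |x| ∂μ ≤ 1 := by
  calc ∫ x, |x| ∂μ ≤ ∫ x, (1 + x ^ 2) / 2 ∂μ := by
        refine integral_mono (integrable_id_of_integrable_sq hμ).abs
          (((integrable_const _).add hμ).div_const _) fun x => ?_
        nlinarith [sq_nonneg (|x| - 1), sq_abs x]
    _ = 1 := by
        rw [integral_div, integral_add (integrable_const _) hμ, variance]
        simp

theorem tendsto_sqrt_mul_pow_sub {κ : ℝ} (hκ0 : 0 < κ) (hκ1 : κ < 1) (m : ℕ) :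
    Tendsto (fun n : ℕ => √n * κ ^ (n - m)) atTop (𝓝 0) := by
  refine (tendsto_add_atTop_iff_nat m).1 ?_
  have limit := (tendsto_self_mul_const_pow_of_lt_one hκ0.le hκ1).add
    ((tendsto_pow_atTop_nhds_zero_of_lt_one hκ0.le hκ1).const_mul (m + 1 : ℝ))
  rw [mul_zero, add_zero] at limit
  refine squeeze_zero (fun n => by positivity) (fun n => ?_) limit
  have sqrt_le : √(n + m : ℕ) ≤ n + (m + 1) := by
    rw [Real.sqrt_le_left (by positivity)]
    push_cast
    nlinarith [show (0 : ℝ) ≤ n from n.cast_nonneg, show (0 : ℝ) ≤ m from m.cast_nonneg]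
  rw [Nat.add_sub_cancel, ← add_mul]
  gcongr

namespace IsUniformCLTFamily

variable {m n : ℕ} {A : NNReal} {𝒦 : Set (Measure ℝ)} {μ : Measure ℝ}

theorem integrable_id (h : IsUniformCLTFamily m A 𝒦) (hμ : μ ∈ 𝒦) : Integrable (fun x => x) μ :=
  have := h.isProbabilityMeasure μ hμ
  integrable_id_of_integrable_sq (h.integrable_sq μ hμ)

theorem exists_norm_charFun_le (h : IsUniformCLTFamily m A 𝒦) {δ : ℝ} (hδ : 0 < δ) :
    ∃ κ : ℝ, 0 < κ ∧ κ < 1 ∧ ∀ μ ∈ 𝒦, ∀ t, δ ≤ |t| → ‖charFun μ t‖ ≤ κ := by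
  obtain ⟨κ, κ_pos, κ_lt, hκ⟩ := CondTensor.exists_norm_charFun_le m A hδ
  refine ⟨κ, κ_pos, κ_lt, fun μ hμ => ?_⟩
  have := h.isProbabilityMeasure μ hμ
  exact hκ μ this (h.integrable_id hμ)
    (integral_abs_le_one (h.integrable_sq μ hμ) (h.variance μ hμ)) (h.lintegral_charFun_pow_le μ hμ)

theorem exists_norm_charFun_sub_taylor_le (h : IsUniformCLTFamily m A 𝒦) {ε : ℝ} (hε : 0 < ε) :
    ∃ δ > 0, ∀ μ ∈ 𝒦, ∀ t, |t| ≤ δ → ‖charFun μ t - (1 - t ^ 2 / 2 : ℝ)‖ ≤ ε * t ^ 2 := by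
  obtain ⟨R, hR, tail_le⟩ := h.exists_tail_le (ε / 8) (by positivity)
  refine ⟨ε / (8 * (R + 1)), by positivity, fun μ hμ t ht => ?_⟩
  have := h.isProbabilityMeasure μ hμ
  have linear_le : |t| * R ≤ ε / 8 := by
    rw [le_div_iff₀ (by positivity)] at ht
    linarith [abs_nonneg t]
  calc ‖charFun μ t - (1 - t ^ 2 / 2 : ℝ)‖
      ≤ 4 * t ^ 2 * (|t| * R + ∫ x in {x | R ≤ |x|}, x ^ 2 ∂μ) :=
        norm_charFun_sub_taylor_le hR (h.integrable_id hμ) (h.integrable_sq μ hμ) (h.mean μ hμ)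
          (h.variance μ hμ) t
    _ ≤ 4 * t ^ 2 * (ε / 8 + ε / 8) := by gcongr; exact tail_le μ hμ
    _ = ε * t ^ 2 := by ring

theorem integrable_charFun_pow (h : IsUniformCLTFamily m A 𝒦) (hμ : μ ∈ 𝒦) (hn : m ≤ n) :
    Integrable fun t => charFun μ t ^ n := by
  have := h.isProbabilityMeasure μ hμ
  have integrable : Integrable fun t => charFun μ t ^ m := by
    refine ⟨(continuous_charFun.pow m).aestronglyMeasurable, ?_⟩
    simp only [HasFiniteIntegral, enorm_pow]
    exact (h.lintegral_charFun_pow_le μ hμ).trans_lt ENNReal.coe_lt_top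
  refine integrable.mono (continuous_charFun.pow n).aestronglyMeasurable (.of_forall fun t => ?_)
  rw [norm_pow, norm_pow]
  exact pow_le_pow_of_le_one (norm_nonneg _) (norm_charFun_le_one t) hn

theorem integral_norm_charFun_pow_le (h : IsUniformCLTFamily m A 𝒦) (hμ : μ ∈ 𝒦) :
    ∫ t, ‖charFun μ t‖ ^ m ≤ A := by
  have := h.isProbabilityMeasure μ hμ
  rw [integral_eq_lintegral_of_nonneg_ae (.of_forall fun t => by positivity)
    (by fun_prop)]
  refine ENNReal.toReal_le_of_le_ofReal A.coe_nonneg ?_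
  simp only [ENNReal.ofReal_pow (norm_nonneg _), ofReal_norm, ENNReal.ofReal_coe_nnreal]
  exact h.lintegral_charFun_pow_le μ hμ

theorem exists_norm_charFun_pow_sub_exp_le (h : IsUniformCLTFamily m A 𝒦) {ε : ℝ} (hε : 0 < ε)
    (hε4 : ε ≤ 1 / 4) : ∃ δ > 0, ∃ κ, 0 < κ ∧ κ < 1 ∧ ∀ μ ∈ 𝒦, ∀ n, 2 ≤ n → m ≤ n → ∀ s : ℝ,
      ‖charFun μ s ^ n - (Real.exp (-(n * s ^ 2 / 2)) : ℝ)‖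
        ≤ (32 * ε + 16 / (δ ^ 2 * n)) * Real.exp (-(n * s ^ 2 / 16))
          + κ ^ (n - m) * ‖charFun μ s‖ ^ m := by
  obtain ⟨δ₁, δ₁_pos, taylor⟩ := h.exists_norm_charFun_sub_taylor_le hε
  set δ := min δ₁ (√(4 * ε))
  have δ_pos : 0 < δ := by positivity
  obtain ⟨κ, κ_pos, κ_lt, cramer⟩ := h.exists_norm_charFun_le δ_pos
  refine ⟨δ, δ_pos, κ, κ_pos, κ_lt, fun μ hμ n hn hmn s => ?_⟩
  rcases le_total |s| δ with hs | hs
  · have s_sq_le : s ^ 2 ≤ 4 * ε := by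
      rw [← Real.sqrt_le_sqrt_iff (by positivity), Real.sqrt_sq_eq_abs]
      exact hs.trans (min_le_right _ _)
    refine (norm_pow_sub_exp_le hn hε4 s_sq_le
      (taylor μ hμ s (hs.trans (min_le_left _ _)))).trans ?_
    rw [add_mul, add_assoc]
    exact le_add_of_nonneg_right (by positivity)
  · refine (norm_pow_sub_exp_le_of_norm_le (by omega) hmn δ_pos hs (cramer μ hμ s hs)).trans ?_
    gcongr
    exact le_add_of_nonneg_left (by positivity)

theorem sqrt_mul_integral_norm_charFun_pow_sub_exp_le (h : IsUniformCLTFamily m A 𝒦)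
    (hμ : μ ∈ 𝒦) (hn : n ≠ 0) {b c : ℝ} (hb : 0 ≤ b)
    (hbc : ∀ s : ℝ, ‖charFun μ s ^ n - (Real.exp (-(n * s ^ 2 / 2)) : ℝ)‖
      ≤ c * Real.exp (-(n * s ^ 2 / 16)) + b * ‖charFun μ s‖ ^ m) :
    √n * ∫ s : ℝ, ‖charFun μ s ^ n - (Real.exp (-(n * s ^ 2 / 2)) : ℝ)‖
      ≤ c * √(16 * Real.pi) + √n * b * A := by
  have n_pos : (0 : ℝ) < n := by positivity
  have exp_eq (s : ℝ) : Real.exp (-(n * s ^ 2 / 16)) = Real.exp (-(n / 16) * s ^ 2) := by ring_nf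
  have sqrt_mul : √n * √(Real.pi / (n / 16)) = √(16 * Real.pi) := by
    rw [← Real.sqrt_mul n_pos.le]
    congr 1
    field_simp
  have integrable_exp : Integrable fun s : ℝ => c * Real.exp (-(n / 16) * s ^ 2) :=
    (integrable_exp_neg_mul_sq (by positivity)).const_mul _
  have integrable_pow : Integrable fun s => b * ‖charFun μ s‖ ^ m := by
    simpa only [norm_pow] using (h.integrable_charFun_pow hμ le_rfl).norm.const_mul b
  simp only [exp_eq] at hbc
  calc √n * ∫ s : ℝ, ‖charFun μ s ^ n - (Real.exp (-(n * s ^ 2 / 2)) : ℝ)‖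
      ≤ √n * ∫ s : ℝ, (c * Real.exp (-(n / 16) * s ^ 2) + b * ‖charFun μ s‖ ^ m) := by
        gcongr √n * ?_
        exact integral_mono_of_nonneg (.of_forall fun s => norm_nonneg _)
          (integrable_exp.add integrable_pow) (.of_forall hbc)
    _ = √n * (c * √(Real.pi / (n / 16)) + b * ∫ s, ‖charFun μ s‖ ^ m) := by
        rw [integral_add integrable_exp integrable_pow, integral_const_mul, integral_const_mul,
          integral_gaussian]
    _ ≤ √n * (c * √(Real.pi / (n / 16)) + b * A) := by
        gcongr
        exact h.integral_norm_charFun_pow_le hμ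
    _ = c * √(16 * Real.pi) + √n * b * A := by
        rw [← sqrt_mul]; ring

theorem eventually_sqrt_mul_integral_norm_le (h : IsUniformCLTFamily m A 𝒦) {η : ℝ}
    (hη : 0 < η) : ∀ᶠ n : ℕ in atTop, ∀ μ ∈ 𝒦,
      √n * ∫ s : ℝ, ‖charFun μ s ^ n - (Real.exp (-(n * s ^ 2 / 2)) : ℝ)‖ ≤ η := by
  set C := √(16 * Real.pi)
  set ε := min (1 / 4) (η / (64 * (C + 1)))
  have ε_pos : 0 < ε := by positivity
  have ε_mul_le : 32 * ε * C ≤ η / 2 := by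
    have := min_le_right (1 / 4) (η / (64 * (C + 1)))
    rw [le_div_iff₀ (by positivity)] at this
    linarith
  obtain ⟨δ, δ_pos, κ, κ_pos, κ_lt, pointwise⟩ :=
    h.exists_norm_charFun_pow_sub_exp_le ε_pos (min_le_left _ _)
  have limit : Tendsto (fun n : ℕ => (32 * ε + 16 / (δ ^ 2 * n)) * C + √n * κ ^ (n - m) * A) atTop
      (𝓝 ((32 * ε + 0) * C + 0 * A)) :=
    (((tendsto_const_nhds.div_atTop (tendsto_natCast_atTop_atTop.const_mul_atTop
      (by positivity))).const_add _).mul_const _).add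
      ((tendsto_sqrt_mul_pow_sub κ_pos κ_lt m).mul_const _)
  filter_upwards [limit.eventually_lt_const (by linarith : _ < η), eventually_ge_atTop 2,
    eventually_ge_atTop m] with n hlt hn hmn μ hμ
  exact (h.sqrt_mul_integral_norm_charFun_pow_sub_exp_le hμ (by omega) (by positivity)
    (pointwise μ hμ n hn hmn)).trans hlt.le

end IsUniformCLTFamily

end UniformCLT

section AdmissibleDensity

open ProbabilityTheory

variable {f : ℝ → ℝ}

namespace IsProbDensity

theorem setIntegral_velocityLaw (hf : IsProbDensity f) (g : ℝ → ℝ) {s : Set ℝ}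
    (hs : MeasurableSet s) : ∫ v in s, g v ∂velocityLaw f = ∫ v in s, f v * g v := by
  rw [velocityLaw, setIntegral_withDensity_eq_setIntegral_toReal_smul₀
    hf.integrable.aemeasurable.ennreal_ofReal.restrict (by simp) g hs]
  refine integral_congr_ae (ae_restrict_of_ae ?_)
  filter_upwards [hf.nonneg] with v hv
  rw [ENNReal.toReal_ofReal hv, smul_eq_mul]

theorem integral_velocityLaw (hf : IsProbDensity f) (g : ℝ → ℝ) :
    ∫ v, g v ∂velocityLaw f = ∫ v, f v * g v := by
  simpa only [setIntegral_univ] using hf.setIntegral_velocityLaw g .univ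

theorem integrable_velocityLaw_iff (hf : IsProbDensity f) {g : ℝ → ℝ} :
    Integrable g (velocityLaw f) ↔ Integrable fun v => f v * g v := by
  rw [velocityLaw, integrable_withDensity_iff_integrable_smul₀'
    hf.integrable.aemeasurable.ennreal_ofReal (by simp)]
  refine integrable_congr ?_
  filter_upwards [hf.nonneg] with v hv
  rw [ENNReal.toReal_ofReal hv, smul_eq_mul]

theorem energy_eq_integral (hf : IsProbDensity f) : energy f = ∫ v, v ^ 2 ∂velocityLaw f :=
  (hf.integral_velocityLaw _).symm

theorem energy_nonneg (hf : IsProbDensity f) : 0 ≤ energy f :=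
  hf.energy_eq_integral ▸ integral_nonneg fun v => sq_nonneg v

theorem energyDev_sq (hf : IsProbDensity f) :
    energyDev f ^ 2 = Var[fun v => v ^ 2; velocityLaw f] := by
  rw [variance_eq_integral (by fun_prop), ← hf.energy_eq_integral, hf.integral_velocityLaw,
    energyDev, Real.sq_sqrt]
  · simp only [mul_comm]
  · refine integral_nonneg_of_ae ?_
    filter_upwards [hf.nonneg] with v hv
    positivity

theorem energyDev_sq_le (hf : IsProbDensity f) :
    energyDev f ^ 2 ≤ ∫ v, v ^ 4 ∂velocityLaw f := by
  have := hf.isProbabilityMeasure_velocityLaw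
  rw [hf.energyDev_sq]
  refine (variance_le_expectation_sq (by fun_prop)).trans_eq ?_
  simp only [Pi.pow_apply, ← pow_mul, Nat.reduceMul]

theorem integral_pow_four_le (hf : IsProbDensity f) (h4 : Integrable fun v => f v * v ^ 4)
    (R : ℝ) : ∫ v, v ^ 4 ∂velocityLaw f ≤ R ^ 4 + ∫ v in {v | R ≤ |v|}, f v * v ^ 4 := by
  have := hf.isProbabilityMeasure_velocityLaw
  have hs : MeasurableSet {v : ℝ | R ≤ |v|} := measurableSet_le measurable_const (by fun_prop)
  rw [← hf.integrable_velocityLaw_iff] at h4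
  rw [← hf.setIntegral_velocityLaw _ hs, ← integral_indicator hs]
  calc ∫ v, v ^ 4 ∂velocityLaw f
      ≤ ∫ v, (R ^ 4 + {v | R ≤ |v|}.indicator (fun v => v ^ 4) v) ∂velocityLaw f := by
        refine integral_mono h4 ((integrable_const _).add (h4.indicator hs)) fun v => ?_
        by_cases hv : R ≤ |v|
        · rw [Set.indicator_of_mem (by exact hv)]
          exact le_add_of_nonneg_left (by positivity)
        · rw [Set.indicator_of_notMem (by exact hv), add_zero, ← Even.pow_abs (by decide) v]
          gcongr
          exact (not_le.1 hv).le
    _ = R ^ 4 + ∫ v, {v | R ≤ |v|}.indicator (fun v => v ^ 4) v ∂velocityLaw f := by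
        rw [integral_add (integrable_const _) (h4.indicator hs)]
        simp

theorem memLp_sq (hf : IsProbDensity f) (h4 : Integrable fun v => f v * v ^ 4) :
    MemLp (fun v => v ^ 2) 2 (velocityLaw f) := by
  rw [memLp_two_iff_integrable_sq (by fun_prop), hf.integrable_velocityLaw_iff]
  simpa only [← pow_mul] using h4

end IsProbDensity

/-- The law of the standardized energy `(v ^ 2 - E) / Σ` of one particle whose velocity has
density `f`. -/
def standardEnergyLaw (f : ℝ → ℝ) : Measure ℝ :=
  (velocityLaw f).map fun v => (v ^ 2 - energy f) / energyDev f

theorem IsProbDensity.isProbabilityMeasure_standardEnergyLaw (hf : IsProbDensity f) :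
    IsProbabilityMeasure (standardEnergyLaw f) :=
  have := hf.isProbabilityMeasure_velocityLaw
  Measure.isProbabilityMeasure_map (by fun_prop)

theorem charFun_energyLaw (hf0 : energyDev f ≠ 0) (t : ℝ) :
    charFun (energyLaw f) t
      = charFun (standardEnergyLaw f) (energyDev f * t)
        * Complex.exp (energy f * t * Complex.I) := by
  have map_eq : energyLaw f
      = ((standardEnergyLaw f).map (energyDev f * ·)).map (· + energy f) := by
    rw [energyLaw, standardEnergyLaw, Measure.map_map (by fun_prop) (by fun_prop),
      Measure.map_map (by fun_prop) (by fun_prop)]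
    congr 1
    ext v
    simp only [Function.comp_apply]
    field_simp
    ring
  rw [map_eq, charFun_map_add_const, charFun_map_mul, real_inner_comm]
  simp

theorem integral_standardEnergyLaw (hf : IsProbDensity f)
    (h4 : Integrable fun v => f v * v ^ 4) : ∫ x, x ∂standardEnergyLaw f = 0 := by
  have := hf.isProbabilityMeasure_velocityLaw
  rw [standardEnergyLaw, integral_map (by fun_prop) (by fun_prop), integral_div,
    integral_sub ((hf.memLp_sq h4).integrable one_le_two) (integrable_const _),
    ← hf.energy_eq_integral]
  simp

theorem integral_sq_standardEnergyLaw (hf : IsProbDensity f) (hf0 : energyDev f ≠ 0) :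
    ∫ x, x ^ 2 ∂standardEnergyLaw f = 1 := by
  rw [standardEnergyLaw, integral_map (by fun_prop) (by fun_prop)]
  simp only [div_pow]
  rw [integral_div, hf.energy_eq_integral, ← variance_eq_integral (by fun_prop),
    ← hf.energyDev_sq, div_self (pow_ne_zero 2 hf0)]

theorem integrable_sq_standardEnergyLaw (hf : IsProbDensity f)
    (h4 : Integrable fun v => f v * v ^ 4) :
    Integrable (fun x => x ^ 2) (standardEnergyLaw f) := by
  have := hf.isProbabilityMeasure_velocityLaw
  rw [standardEnergyLaw, integrable_map_measure (by fun_prop) (by fun_prop)]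
  simp only [Function.comp_def, div_pow]
  exact (((hf.memLp_sq h4).sub (memLp_const _)).integrable_sq).div_const _

theorem setIntegral_sq_standardEnergyLaw_le (hf : IsProbDensity f)
    (h4 : Integrable fun v => f v * v ^ 4) (hf0 : 0 < energyDev f) {K R : ℝ}
    (hK : energy f < K * energyDev f) (hR : R ^ 2 ≤ K * energyDev f) :
    ∫ x in {x | K ≤ |x|}, x ^ 2 ∂standardEnergyLaw f
      ≤ (∫ v in {v | R ≤ |v|}, f v * v ^ 4) / energyDev f ^ 2 := by
  have hs : MeasurableSet {v : ℝ | R ≤ |v|} := measurableSet_le measurable_const (by fun_prop)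
  have hK_mble : MeasurableSet {x : ℝ | K ≤ |x|} :=
    measurableSet_le measurable_const (by fun_prop)
  have le_sub {v : ℝ} (hv : K ≤ |(v ^ 2 - energy f) / energyDev f|) :
      K * energyDev f ≤ v ^ 2 - energy f := by
    rw [abs_div, abs_of_pos hf0, le_div_iff₀ hf0] at hv
    rcases le_abs.1 hv with h | h
    · exact h
    · linarith [sq_nonneg v]
  have integrable : Integrable (fun v => v ^ 4 / energyDev f ^ 2) (velocityLaw f) :=
    (hf.integrable_velocityLaw_iff.2 h4).div_const _
  have integrable_std := (integrable_map_measure (by fun_prop) (by fun_prop)).1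
    (integrable_sq_standardEnergyLaw hf h4)
  rw [standardEnergyLaw, setIntegral_map hK_mble (by fun_prop) (by fun_prop),
    ← hf.setIntegral_velocityLaw _ hs, ← integral_div]
  calc ∫ v in {v | K ≤ |(v ^ 2 - energy f) / energyDev f|},
        ((v ^ 2 - energy f) / energyDev f) ^ 2 ∂velocityLaw f
      ≤ ∫ v in {v | K ≤ |(v ^ 2 - energy f) / energyDev f|},
          v ^ 4 / energyDev f ^ 2 ∂velocityLaw f := by
        refine setIntegral_mono_on integrable_std.integrableOn integrable.integrableOn
          (measurableSet_le measurable_const (by fun_prop)) fun v hv => ?_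
        have := le_sub hv
        rw [div_pow]
        gcongr
        nlinarith [hf.energy_nonneg]
    _ ≤ ∫ v in {v | R ≤ |v|}, v ^ 4 / energyDev f ^ 2 ∂velocityLaw f := by
        refine setIntegral_mono_set integrable.integrableOn (.of_forall fun v => by positivity)
          (Eventually.of_forall fun v hv => (le_abs_self R).trans (sq_le_sq.1 ?_))
        linarith [le_sub hv, hf.energy_nonneg]

end AdmissibleDensity

section UniformLocalLimit

variable {p Emax Smin L : ℝ} {χ : ℝ → ℝ} {f : ℝ → ℝ} {N : ℕ} {q : ℝ}

theorem eLpNorm_le_one_add_rpow (hf : IsProbDensity f) (hq : 1 ≤ q) (hqp : q ≤ p) :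
    eLpNorm f (ENNReal.ofReal q) ≤ 1 + eLpNorm f (ENNReal.ofReal p) ^ p := by
  have q_pos : 0 < q := by linarith
  have p_pos : 0 < p := by linarith
  have lintegral_eq_one : ∫⁻ v, ‖f v‖ₑ = 1 := by
    rw [← ENNReal.ofReal_one, ← hf.integral_eq_one,
      ofReal_integral_eq_lintegral_ofReal hf.integrable hf.nonneg]
    exact lintegral_congr_ae (hf.nonneg.mono fun v hv => Real.enorm_of_nonneg hv)
  have eLpNorm_rpow {a : ℝ} (ha : 0 < a) :
      eLpNorm f (ENNReal.ofReal a) ^ a = ∫⁻ v, ‖f v‖ₑ ^ a := by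
    rw [eLpNorm_eq_lintegral_rpow_enorm_toReal (by simpa using ha) (by simp),
      ENNReal.toReal_ofReal ha.le, one_div, ENNReal.rpow_inv_rpow ha.ne']
  have pointwise (x : ℝ≥0∞) : x ^ q ≤ x + x ^ p := by
    rcases le_total x 1 with h | h
    · exact le_add_right (by simpa using ENNReal.rpow_le_rpow_of_exponent_ge h hq)
    · exact le_add_left (ENNReal.rpow_le_rpow_of_exponent_le h hqp)
  have rpow_le : eLpNorm f (ENNReal.ofReal q) ^ q ≤ 1 + eLpNorm f (ENNReal.ofReal p) ^ p := by
    rw [eLpNorm_rpow q_pos, eLpNorm_rpow p_pos, ← lintegral_eq_one,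
      ← lintegral_add_left' hf.integrable.aemeasurable.enorm]
    exact lintegral_mono fun v => pointwise _
  rcases le_total (eLpNorm f (ENNReal.ofReal q)) 1 with h | h
  · exact h.trans le_self_add
  · exact (by simpa using ENNReal.rpow_le_rpow_of_exponent_le h hq :).trans rpow_le

theorem one_le_div_sub_two (hN : 3 ≤ N) : (1 : ℝ) ≤ N / (N - 2) := by
  have : (3 : ℝ) ≤ N := by exact_mod_cast hN
  rw [one_le_div (by linarith)]
  linarith

theorem eventually_div_sub_two_le (hp : 1 < p) : ∀ᶠ N : ℕ in atTop, (N : ℝ) / (N - 2) ≤ p := by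
  filter_upwards [tendsto_natCast_atTop_atTop.eventually_ge_atTop (2 * p / (p - 1)),
    eventually_gt_atTop 2] with N hN hN2
  have : (2 : ℝ) < N := by exact_mod_cast hN2
  rw [div_le_iff₀ (by linarith)] at hN
  rw [div_le_iff₀ (by linarith)]
  linarith

/-- The class of probability densities, with mean energy, energy deviation, `L^p` norm and
fourth-moment tails controlled by the given parameters, over which the estimates are uniform. -/
structure IsAdmissible (p Emax Smin L : ℝ) (χ : ℝ → ℝ) (f : ℝ → ℝ) : Prop
    extends IsProbDensity f where
  integrable_pow_four : Integrable fun v => f v * v ^ 4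
  energy_le : energy f ≤ Emax
  le_energyDev : Smin ≤ energyDev f
  eLpNorm_le : eLpNorm f (ENNReal.ofReal p) ≤ ENNReal.ofReal L
  tail_le : ∀ r > 0, ∫ v in {v | 1 / r ≤ |v|}, f v * v ^ 4 ≤ χ r

namespace IsAdmissible

theorem eLpNorm_le_of_le (h : IsAdmissible p Emax Smin L χ f) (hq : 1 ≤ q) (hqp : q ≤ p) :
    eLpNorm f (ENNReal.ofReal q) ≤ 1 + ENNReal.ofReal L ^ p :=
  (eLpNorm_le_one_add_rpow h.toIsProbDensity hq hqp).trans <| by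
    gcongr
    · linarith
    · exact h.eLpNorm_le

theorem memLp_of_le (h : IsAdmissible p Emax Smin L χ f) (hq : 1 ≤ q) (hqp : q ≤ p) :
    MemLp f (ENNReal.ofReal q) := by
  refine ⟨h.integrable.1, (h.eLpNorm_le_of_le hq hqp).trans_lt ?_⟩
  have : ENNReal.ofReal L ^ p < ∞ := ENNReal.rpow_lt_top_of_nonneg (by linarith) (by simp)
  exact ENNReal.add_lt_top.2 ⟨by simp, this⟩

end IsAdmissible

theorem exists_energyDev_le (hχ : Tendsto χ (𝓝[>] 0) (𝓝 0)) :
    ∃ K : ℝ, ∀ f, IsAdmissible p Emax Smin L χ f → energyDev f ≤ K := by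
  obtain ⟨r, hr, r_pos⟩ := ((hχ.eventually_lt_const one_pos).and self_mem_nhdsWithin).exists
  refine ⟨√((1 / r) ^ 4 + 1), fun f h => Real.le_sqrt_of_sq_le ?_⟩
  linarith [h.energyDev_sq_le, h.integral_pow_four_le h.integrable_pow_four (1 / r),
    h.tail_le r r_pos]

theorem exists_setIntegral_sq_standardEnergyLaw_le (hSmin : 0 < Smin)
    (hχ : Tendsto χ (𝓝[>] 0) (𝓝 0)) {ε : ℝ} (hε : 0 < ε) :
    ∃ K ≥ 0, ∀ f, IsAdmissible p Emax Smin L χ f →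
      ∫ x in {x | K ≤ |x|}, x ^ 2 ∂standardEnergyLaw f ≤ ε := by
  obtain ⟨r, hr, r_pos⟩ := ((hχ.eventually_lt_const (by positivity : 0 < ε * Smin ^ 2)).and
    self_mem_nhdsWithin).exists
  refine ⟨((1 / r) ^ 2 + (|Emax| + 1)) / Smin, by positivity, fun f h => ?_⟩
  have dev_pos : 0 < energyDev f := hSmin.trans_le h.le_energyDev
  have le_mul : (1 / r) ^ 2 + (|Emax| + 1)
      ≤ ((1 / r) ^ 2 + (|Emax| + 1)) / Smin * energyDev f := by
    rw [div_mul_eq_mul_div, le_div_iff₀ hSmin]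
    gcongr
    exact h.le_energyDev
  refine (setIntegral_sq_standardEnergyLaw_le h.toIsProbDensity h.integrable_pow_four dev_pos
    (R := 1 / r) ?_ ?_).trans ?_
  · linarith [h.energy_le, le_abs_self Emax, sq_nonneg (1 / r)]
  · linarith [abs_nonneg Emax]
  · rw [div_le_iff₀ (by positivity)]
    refine ((h.tail_le r r_pos).trans hr.le).trans ?_
    gcongr
    exact h.le_energyDev

theorem lintegral_enorm_charFun_energyLaw_pow_le (hN : 3 ≤ N) (hq : q = N / (N - 2))
    (hf : IsProbDensity f) (hfq : MemLp f (ENNReal.ofReal q)) :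
    ∫⁻ t, ‖charFun (energyLaw f) t‖ₑ ^ (2 * N)
      ≤ ENNReal.ofReal (2 * Real.pi)
        * (ENNReal.ofReal Real.pi * eLpNorm f (ENNReal.ofReal q) ^ N) := by
  have := isProbabilityMeasure_withDensity_energyDensity hN hq hf hfq
  refine le_of_eq_of_le ?_ (lintegral_enorm_charFun_sq_le
    (μ := volume.withDensity fun s => ENNReal.ofReal (energyDensity N f s)) ?_)
  · refine lintegral_congr fun t => ?_
    rw [charFun_withDensity_energyDensity hN hq hf hfq, enorm_pow, ← pow_mul, mul_comm]
  · rw [← withDensity_const]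
    refine withDensity_mono (.of_forall fun s => ?_)
    dsimp only
    rw [← Real.enorm_of_nonneg (energyDensity_nonneg hN hf.nonneg)]
    exact enorm_energyDensity_le hN hq hfq.1 s

theorem lintegral_comp_const_mul (g : ℝ → ℝ≥0∞) {a : ℝ} (ha : 0 < a) :
    ∫⁻ x, g x = ENNReal.ofReal a * ∫⁻ x, g (a * x) := by
  conv_lhs => rw [← Real.smul_map_volume_mul_left ha.ne', abs_of_pos ha, lintegral_smul_measure]
  rw [(measurableEmbedding_mulLeft₀ ha.ne').lintegral_map g, smul_eq_mul]

theorem lintegral_enorm_charFun_standardEnergyLaw_pow (hf0 : 0 < energyDev f) (n : ℕ) :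
    ∫⁻ t, ‖charFun (standardEnergyLaw f) t‖ₑ ^ n
      = ENNReal.ofReal (energyDev f) * ∫⁻ t, ‖charFun (energyLaw f) t‖ₑ ^ n := by
  rw [lintegral_comp_const_mul _ hf0]
  congr 1
  refine lintegral_congr fun t => ?_
  rw [charFun_energyLaw hf0.ne', enorm_mul, ← Complex.ofReal_mul, Complex.enorm_exp_ofReal_mul_I,
    mul_one]

theorem exists_isUniformCLTFamily_standardEnergyLaw (hp : 1 < p) (hSmin : 0 < Smin)
    (hχ : Tendsto χ (𝓝[>] 0) (𝓝 0)) : ∃ m A,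
      IsUniformCLTFamily m A (standardEnergyLaw '' {f | IsAdmissible p Emax Smin L χ f}) := by
  obtain ⟨N, hNp, hN⟩ := ((eventually_div_sub_two_le hp).and (eventually_ge_atTop 3)).exists
  obtain ⟨K, hK⟩ := exists_energyDev_le (p := p) (Emax := Emax) (Smin := Smin) (L := L) hχ
  set B : ℝ≥0∞ := ENNReal.ofReal K * (ENNReal.ofReal (2 * Real.pi)
    * (ENNReal.ofReal Real.pi * (1 + ENNReal.ofReal L ^ p) ^ N))
  have B_ne_top : B ≠ ∞ := by
    have : ENNReal.ofReal L ^ p ≠ ∞ := ENNReal.rpow_ne_top_of_nonneg (by linarith) (by simp)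
    finiteness
  have dev_pos {f : ℝ → ℝ} (h : IsAdmissible p Emax Smin L χ f) : 0 < energyDev f :=
    hSmin.trans_le h.le_energyDev
  refine ⟨2 * N, B.toNNReal, ⟨?_, ?_, ?_, ?_, fun ε hε => ?_, ?_⟩⟩
  · exact Set.forall_mem_image.2 fun f h => h.isProbabilityMeasure_standardEnergyLaw
  · exact Set.forall_mem_image.2 fun f h =>
      integrable_sq_standardEnergyLaw h.toIsProbDensity h.integrable_pow_four
  · exact Set.forall_mem_image.2 fun f h =>
      integral_standardEnergyLaw h.toIsProbDensity h.integrable_pow_four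
  · exact Set.forall_mem_image.2 fun f h =>
      integral_sq_standardEnergyLaw h.toIsProbDensity (dev_pos h).ne'
  · obtain ⟨R, hR, tail_le⟩ := exists_setIntegral_sq_standardEnergyLaw_le hSmin hχ hε
    exact ⟨R, hR, Set.forall_mem_image.2 tail_le⟩
  · refine Set.forall_mem_image.2 fun f h => ?_
    rw [ENNReal.coe_toNNReal B_ne_top, lintegral_enorm_charFun_standardEnergyLaw_pow (dev_pos h)]
    refine mul_le_mul' (ENNReal.ofReal_le_ofReal (hK f h))
      ((lintegral_enorm_charFun_energyLaw_pow_le hN rfl h.toIsProbDensity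
        (h.memLp_of_le (one_le_div_sub_two hN) hNp)).trans ?_)
    gcongr
    exact h.eLpNorm_le_of_le (one_le_div_sub_two hN) hNp

end UniformLocalLimit

section LocalLimit

open ProbabilityTheory
open scoped NNReal

variable {p Emax Smin L : ℝ} {χ : ℝ → ℝ} {f : ℝ → ℝ} {N : ℕ} {q : ℝ}

theorem continuous_gaussianPDFReal (m : ℝ) (v : ℝ≥0) : Continuous (gaussianPDFReal m v) := by
  rw [gaussianPDFReal_def]
  fun_prop

theorem integrable_charFun_gaussianReal (m : ℝ) {v : ℝ≥0} (hv : v ≠ 0) :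
    Integrable (charFun (gaussianReal m v)) := by
  refine ((GaussianFourier.integrable_cexp_neg_mul_sq_norm_add (V := ℝ) (b := (v / 2 : ℝ))
    (by simpa using pos_iff_ne_zero.2 hv) (m * Complex.I) 1)).congr (.of_forall fun t => ?_)
  dsimp only
  rw [charFun_gaussianReal]
  congr 1
  simp only [Real.norm_eq_abs, ← Complex.ofReal_pow, sq_abs, RCLike.inner_apply, map_one,
    mul_one]
  push_cast
  ring

theorem charFun_energyLaw_pow_sub_charFun_gaussianReal (hf0 : energyDev f ≠ 0) (N : ℕ) (t : ℝ) :
    charFun (energyLaw f) t ^ N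
        - charFun (gaussianReal (N * energy f) (N * energyDev f ^ 2).toNNReal) t
      = (charFun (standardEnergyLaw f) (energyDev f * t) ^ N
          - (Real.exp (-(N * (energyDev f * t) ^ 2 / 2)) : ℝ))
        * Complex.exp ((N * energy f * t : ℝ) * Complex.I) := by
  rw [charFun_energyLaw hf0, charFun_gaussianReal, Real.coe_toNNReal _ (by positivity), mul_pow,
    ← Complex.exp_nat_mul, sub_mul, Complex.ofReal_exp, ← Complex.exp_add]
  push_cast
  ring_nf

theorem abs_energyDensity_sub_gaussianPDFReal_le (hN : 3 ≤ N) (hq : q = N / (N - 2))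
    (hf : IsProbDensity f) (hfq : MemLp f (ENNReal.ofReal q)) (hf0 : 0 < energyDev f)
    (hφ : Integrable fun t => charFun (standardEnergyLaw f) t ^ N) (s : ℝ) :
    |energyDensity N f s - gaussianPDFReal (N * energy f) (N * energyDev f ^ 2).toNNReal s|
      ≤ (2 * Real.pi * energyDev f)⁻¹ * ∫ t : ℝ, ‖charFun (standardEnergyLaw f) t ^ N
        - (Real.exp (-(N * t ^ 2 / 2)) : ℝ)‖ := by
  set m := N * energy f
  set v : ℝ≥0 := (N * energyDev f ^ 2).toNNReal
  have v_ne_zero : v ≠ 0 := (Real.toNNReal_pos.2 (by positivity)).ne'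
  have charFun_density : charFun (volume.withDensity fun s => ENNReal.ofReal (energyDensity N f s))
      = fun t => charFun (energyLaw f) t ^ N :=
    funext (charFun_withDensity_energyDensity hN hq hf hfq)
  have gaussian_eq :
      volume.withDensity (fun x => ENNReal.ofReal (gaussianPDFReal m v x)) = gaussianReal m v :=
    (gaussianReal_of_var_ne_zero m v_ne_zero).symm
  have integrable_pow : Integrable fun t => charFun (energyLaw f) t ^ N := by
    have sub_integrable := (hφ.comp_mul_left' hf0.ne').bdd_mul (c := 1)
      (f := fun t : ℝ => Complex.exp ((m * t : ℝ) * Complex.I)) (by fun_prop)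
      (.of_forall fun t => (Complex.norm_exp_ofReal_mul_I _).le)
    refine sub_integrable.congr (.of_forall fun t => ?_)
    dsimp only
    rw [charFun_energyLaw hf0.ne', mul_pow, ← Complex.exp_nat_mul, mul_comm]
    congr 2
    push_cast [m]
    ring
  have := isProbabilityMeasure_withDensity_energyDensity hN hq hf hfq
  have : IsFiniteMeasure (volume.withDensity fun x => ENNReal.ofReal (gaussianPDFReal m v x)) := by
    rw [gaussian_eq]
    infer_instance
  refine (abs_sub_le_integral_norm_charFun_sub (continuous_energyDensity hN hq hfq)
    (fun _ => energyDensity_nonneg hN hf.nonneg) (continuous_gaussianPDFReal m v)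
    (gaussianPDFReal_nonneg m v) (by rwa [charFun_density])
    (by rw [gaussian_eq]; exact integrable_charFun_gaussianReal m v_ne_zero) s).trans_eq ?_
  rw [charFun_density, gaussian_eq, mul_inv _ (energyDev f), mul_assoc]
  congr 1
  have norm_sub_eq (t : ℝ) : ‖charFun (energyLaw f) t ^ N - charFun (gaussianReal m v) t‖
      = ‖charFun (standardEnergyLaw f) (energyDev f * t) ^ N
        - (Real.exp (-(N * (energyDev f * t) ^ 2 / 2)) : ℝ)‖ := by
    rw [charFun_energyLaw_pow_sub_charFun_gaussianReal hf0.ne', norm_mul,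
      Complex.norm_exp_ofReal_mul_I, mul_one]
  simp_rw [norm_sub_eq]
  rw [Measure.integral_comp_mul_left (fun t : ℝ => ‖charFun (standardEnergyLaw f) t ^ N
    - (Real.exp (-(N * t ^ 2 / 2)) : ℝ)‖), abs_of_pos (by positivity), smul_eq_mul]

/-- The density of the energy `∑ v_j ^ 2` under `f^{⊗N}`, rescaled so that its Gaussian
approximation is `exp (-(s - N E) ^ 2 / (2 N Σ ^ 2))`. -/
def rescaledEnergyDensity (N : ℕ) (f : ℝ → ℝ) (s : ℝ) : ℝ :=
  √(2 * Real.pi) * √N * energyDev f * energyDensity N f s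

/-- The Gaussian profile `exp (-(s - N E) ^ 2 / (2 N Σ ^ 2))`. -/
def gaussianProfile (N : ℕ) (f : ℝ → ℝ) (s : ℝ) : ℝ :=
  Real.exp (-(s - N * energy f) ^ 2 / (2 * N * energyDev f ^ 2))

theorem gaussianProfile_nonneg (N : ℕ) (f : ℝ → ℝ) (s : ℝ) : 0 ≤ gaussianProfile N f s :=
  (Real.exp_pos _).le

theorem gaussianProfile_le_one (N : ℕ) (f : ℝ → ℝ) (s : ℝ) : gaussianProfile N f s ≤ 1 := by
  rw [gaussianProfile, Real.exp_le_one_iff, neg_div, neg_nonpos]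
  positivity

theorem mul_gaussianPDFReal_eq_gaussianProfile (hN : N ≠ 0) (hf0 : 0 < energyDev f) (s : ℝ) :
    √(2 * Real.pi) * √N * energyDev f
        * gaussianPDFReal (N * energy f) (N * energyDev f ^ 2).toNNReal s
      = gaussianProfile N f s := by
  rw [gaussianPDFReal, gaussianProfile, Real.coe_toNNReal _ (by positivity),
    Real.sqrt_mul (by positivity) (N * _), Real.sqrt_mul (by positivity) (_ ^ 2),
    Real.sqrt_sq hf0.le]
  have : 0 < N := pos_iff_ne_zero.2 hN
  field_simp

theorem eventually_abs_rescaledEnergyDensity_sub_le (hp : 1 < p) (hSmin : 0 < Smin)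
    (hχ : Tendsto χ (𝓝[>] 0) (𝓝 0)) {η : ℝ} (hη : 0 < η) :
    ∀ᶠ N : ℕ in atTop, ∀ f, IsAdmissible p Emax Smin L χ f → ∀ s,
      |rescaledEnergyDensity N f s - gaussianProfile N f s| ≤ η := by
  obtain ⟨m, A, clt⟩ :=
    exists_isUniformCLTFamily_standardEnergyLaw (Emax := Emax) (L := L) hp hSmin hχ
  filter_upwards [clt.eventually_sqrt_mul_integral_norm_le hη, eventually_ge_atTop m,
    eventually_ge_atTop 3, eventually_div_sub_two_le hp] with N integral_le hmN hN hNp f h s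
  have dev_pos : 0 < energyDev f := hSmin.trans_le h.le_energyDev
  have law_mem := Set.mem_image_of_mem standardEnergyLaw h
  have local_limit := abs_energyDensity_sub_gaussianPDFReal_le hN rfl h.toIsProbDensity
    (h.memLp_of_le (one_le_div_sub_two hN) hNp) dev_pos (clt.integrable_charFun_pow law_mem hmN) s
  have two_pi_ge_one : 1 ≤ √(2 * Real.pi) := Real.one_le_sqrt.2 (by linarith [Real.pi_gt_three])
  rw [← mul_gaussianPDFReal_eq_gaussianProfile (by lia) dev_pos, rescaledEnergyDensity, ← mul_sub,
    abs_mul, abs_of_pos (by positivity)]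
  set I := ∫ t : ℝ, ‖charFun (standardEnergyLaw f) t ^ N - (Real.exp (-(N * t ^ 2 / 2)) : ℝ)‖
  calc _ ≤ √(2 * Real.pi) * √N * energyDev f * ((2 * Real.pi * energyDev f)⁻¹ * I) := by gcongr
    _ = (√(2 * Real.pi))⁻¹ * (√N * I) := by
      rw [← Real.sq_sqrt (by positivity : 0 ≤ 2 * Real.pi)]
      field_simp
      simp
    _ ≤ 1 * η := by
      gcongr
      · exact inv_le_one_of_one_le₀ two_pi_ge_one
      · exact integral_le _ law_mem
    _ = η := one_mul η

end LocalLimit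

section StandardGaussian

open ProbabilityTheory

variable {N : ℕ} {r s t : ℝ}

/-- The standard Gaussian density on the line; its partition function `Z_N` is explicit, which
fixes the normalisation in the asymptotics of all the others. -/
def stdGaussian : ℝ → ℝ := gaussianPDFReal 0 1

theorem stdGaussian_apply (v : ℝ) :
    stdGaussian v = (√(2 * Real.pi))⁻¹ * Real.exp (-v ^ 2 / 2) := by
  simp [stdGaussian, gaussianPDFReal]

theorem isProbDensity_stdGaussian : IsProbDensity stdGaussian where
  nonneg := .of_forall (gaussianPDFReal_nonneg 0 1)
  integrable := integrable_gaussianPDFReal 0 1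
  integral_eq_one := integral_gaussianPDFReal_eq_one 0 one_ne_zero

theorem velocityLaw_stdGaussian : velocityLaw stdGaussian = gaussianReal 0 1 :=
  (gaussianReal_of_var_ne_zero 0 one_ne_zero).symm

theorem integrable_stdGaussian_mul_pow (n : ℕ) : Integrable fun v => stdGaussian v * v ^ n := by
  rw [← isProbDensity_stdGaussian.integrable_velocityLaw_iff, velocityLaw_stdGaussian,
    ← integrable_norm_iff (by fun_prop)]
  simpa only [norm_pow, id] using (memLp_id_gaussianReal (μ := 0) (v := 1) n).integrable_norm_pow'

theorem hasDerivAt_stdGaussian (v : ℝ) : HasDerivAt stdGaussian (-(stdGaussian v * v)) v := by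
  simp only [funext stdGaussian_apply]
  refine (((hasDerivAt_pow 2 v).neg.div_const 2).exp.const_mul _).congr_deriv ?_
  simp
  ring

theorem integral_stdGaussian_mul_pow_add_two (n : ℕ) :
    ∫ v, stdGaussian v * v ^ (n + 2) = (n + 1) * ∫ v, stdGaussian v * v ^ n := by
  have deriv_pow (v : ℝ) : HasDerivAt (fun v : ℝ => v ^ (n + 1)) ((n + 1) * v ^ n) v := by
    simpa using hasDerivAt_pow (n + 1) v
  have by_parts := integral_mul_deriv_eq_deriv_mul_of_integrable
    (fun v _ => deriv_pow v) (fun v _ => hasDerivAt_stdGaussian v)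
    ((integrable_stdGaussian_mul_pow (n + 2)).neg.congr (.of_forall fun v => by
      simp only [Pi.mul_apply, Pi.neg_apply]; ring))
    (((integrable_stdGaussian_mul_pow n).const_mul (n + 1 : ℝ)).congr (.of_forall fun v => by
      simp only [Pi.mul_apply]; ring))
    ((integrable_stdGaussian_mul_pow (n + 1)).congr (.of_forall fun v => by
      simp only [Pi.mul_apply]; ring))
  calc ∫ v, stdGaussian v * v ^ (n + 2) = -∫ v, v ^ (n + 1) * -(stdGaussian v * v) := by
        rw [← integral_neg]
        congr 1 with v
        ring
    _ = ∫ v, (n + 1) * v ^ n * stdGaussian v := by rw [by_parts, neg_neg]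
    _ = _ := by
        rw [← integral_const_mul]
        congr 1 with v
        ring

theorem energy_stdGaussian : energy stdGaussian = 1 := by
  have moment_two := integral_stdGaussian_mul_pow_add_two 0
  simpa [energy, isProbDensity_stdGaussian.integral_eq_one] using moment_two

theorem energyDev_stdGaussian : energyDev stdGaussian = √2 := by
  have moment_two : ∫ v, stdGaussian v * v ^ 2 = 1 := energy_stdGaussian
  have moment_four : ∫ v, stdGaussian v * v ^ 4 = 3 := by
    rw [integral_stdGaussian_mul_pow_add_two 2, moment_two]
    norm_num
  have variance_eq : energyDev stdGaussian ^ 2 = 2 := by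
    have := isProbDensity_stdGaussian.isProbabilityMeasure_velocityLaw
    rw [isProbDensity_stdGaussian.energyDev_sq, variance_eq_sub
      (isProbDensity_stdGaussian.memLp_sq (integrable_stdGaussian_mul_pow 4))]
    simp only [Pi.pow_apply, ← pow_mul, Nat.reduceMul,
      isProbDensity_stdGaussian.integral_velocityLaw, moment_two, moment_four]
    norm_num
  rw [← variance_eq]
  exact (Real.sqrt_sq (Real.sqrt_nonneg _)).symm

theorem memLp_two_stdGaussian : MemLp stdGaussian 2 := by
  rw [memLp_two_iff_integrable_sq isProbDensity_stdGaussian.integrable.1]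
  simp_rw [sq]
  refine isProbDensity_stdGaussian.integrable.bdd_mul (c := (√(2 * Real.pi))⁻¹)
    isProbDensity_stdGaussian.integrable.1 (.of_forall fun v => ?_)
  rw [stdGaussian_apply, Real.norm_of_nonneg (by positivity)]
  refine mul_le_of_le_one_right (by positivity) (Real.exp_le_one_iff.2 ?_)
  rw [neg_div, neg_nonpos]
  positivity

theorem tensorPow_stdGaussian (x : EuclideanSpace ℝ (Fin N)) :
    tensorPow stdGaussian N x = gaussRadial N ‖x‖ := by
  simp only [tensorPow, stdGaussian_apply, Finset.prod_mul_distrib, Finset.prod_const,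
    Finset.card_univ, Fintype.card_fin, ← Real.exp_sum, ← Finset.sum_div, Finset.sum_neg_distrib]
  rw [gaussRadial, EuclideanSpace.real_norm_sq_eq, Real.sqrt_eq_rpow, inv_pow,
    ← Real.rpow_natCast, ← Real.rpow_mul (by positivity), one_div_mul_eq_div, inv_mul_eq_div]

theorem Z_stdGaussian (hN : N ≠ 0) (hr : 0 ≤ r) : Z N stdGaussian r = gaussRadial N r := by
  have := isProbabilityMeasure_sphereUnif hN r
  rw [Z, integral_congr_ae (g := fun _ => gaussRadial N r)]
  · simp
  · filter_upwards [ae_sphereUnif_norm_eq hr] with x hx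
    rw [tensorPow_stdGaussian, hx]

theorem energyDensity_stdGaussian (hN : N ≠ 0) (s : ℝ) :
    energyDensity N stdGaussian s = shellDensity N s * gaussRadial N √s := by
  rw [energyDensity, Z_stdGaussian hN (Real.sqrt_nonneg s)]

theorem energyDensity_stdGaussian_pos (hN : N ≠ 0) (hs : 0 < s) :
    0 < energyDensity N stdGaussian s := by
  have := shellDensity_pos hN hs
  rw [energyDensity_stdGaussian hN, gaussRadial]
  positivity

theorem energyDensity_stdGaussian_eq_mul_alpha (hN : 2 ≤ N) (hs : 0 < s) :
    energyDensity N stdGaussian s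
      = sphereArea N / (2 * (2 * Real.pi) ^ ((N : ℝ) / 2)) * alpha N s := by
  have sqrt_pow : √s ^ (N - 2) = s ^ ((N : ℝ) / 2 - 1) := by
    rw [Real.sqrt_eq_rpow, ← Real.rpow_natCast, ← Real.rpow_mul hs.le, Nat.cast_sub hN]
    push_cast
    ring_nf
  rw [energyDensity_stdGaussian (by lia), shellDensity, gaussRadial, alpha, sqrt_pow,
    Real.sq_sqrt hs.le]
  field_simp

theorem alpha_div_alpha (hN : 2 ≤ N) (hs : 0 < s) (ht : 0 < t) :
    alpha N s / alpha N t = energyDensity N stdGaussian s / energyDensity N stdGaussian t := by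
  have := sphereArea_pos (N := N) (by lia)
  rw [energyDensity_stdGaussian_eq_mul_alpha hN hs, energyDensity_stdGaussian_eq_mul_alpha hN ht,
    mul_div_mul_left _ _ (by positivity)]

end StandardGaussian

section PartitionFunction

variable {p Emax Smin L : ℝ} {χ : ℝ → ℝ} {f : ℝ → ℝ} {N : ℕ} {r : ℝ}

theorem tendsto_setIntegral_one_div_le_abs {g : ℝ → ℝ} (hg : Integrable g) :
    Tendsto (fun r : ℝ => ∫ v in {v | 1 / r ≤ |v|}, g v) (𝓝[>] 0) (𝓝 0) := by
  have measurableSet_tail (r : ℝ) : MeasurableSet {v : ℝ | 1 / r ≤ |v|} :=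
    measurableSet_le measurable_const (by fun_prop)
  simp_rw [← integral_indicator (measurableSet_tail _)]
  rw [show 𝓝 (0 : ℝ) = 𝓝 (∫ _ : ℝ, (0 : ℝ)) by simp]
  refine tendsto_integral_filter_of_dominated_convergence (fun v => ‖g v‖)
    (.of_forall fun r => (hg.indicator (measurableSet_tail r)).1)
    (.of_forall fun r => .of_forall fun v => norm_indicator_le_norm_self _ _) hg.norm
    (.of_forall fun v => tendsto_const_nhds.congr' ?_)
  filter_upwards [tendsto_inv_nhdsGT_zero.eventually_gt_atTop |v|] with r hr
  rw [Set.indicator_of_notMem]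
  simpa using hr

theorem IsProbDensity.isAdmissible (hf : IsProbDensity f) (h4 : Integrable fun v => f v * v ^ 4)
    (hfp : MemLp f (ENNReal.ofReal p)) :
    IsAdmissible p (energy f) (energyDev f) (eLpNorm f (ENNReal.ofReal p)).toReal
      (fun r => ∫ v in {v | 1 / r ≤ |v|}, f v * v ^ 4) f where
  toIsProbDensity := hf
  integrable_pow_four := h4
  energy_le := le_rfl
  le_energyDev := le_rfl
  eLpNorm_le := (ENNReal.ofReal_toReal hfp.eLpNorm_ne_top).ge
  tail_le _ _ := le_rfl

theorem gaussianProfile_natCast (hN : N ≠ 0) (f : ℝ → ℝ) :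
    gaussianProfile N f N
      = Real.exp (-(N * (1 - energy f) ^ 2) / (2 * energyDev f ^ 2)) := by
  have : (N : ℝ) ≠ 0 := by exact_mod_cast hN
  rw [gaussianProfile, ← mul_div_mul_left _ (2 * energyDev f ^ 2) this]
  ring_nf

theorem eventually_abs_rescaledEnergyDensity_stdGaussian_sub_one_le {η : ℝ} (hη : 0 < η) :
    ∀ᶠ N : ℕ in atTop, |rescaledEnergyDensity N stdGaussian N - 1| ≤ η := by
  have dev_pos : 0 < energyDev stdGaussian := by
    rw [energyDev_stdGaussian]
    positivity
  have admissible := isProbDensity_stdGaussian.isAdmissible (p := 2)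
    (integrable_stdGaussian_mul_pow 4) (by simpa using memLp_two_stdGaussian)
  filter_upwards [eventually_abs_rescaledEnergyDensity_sub_le one_lt_two dev_pos
    (tendsto_setIntegral_one_div_le_abs (integrable_stdGaussian_mul_pow 4)) hη,
    eventually_ne_atTop 0] with N h hN
  simpa [gaussianProfile_natCast hN, energy_stdGaussian] using h _ admissible N

/-- The error term `ε(N, f, r)` in the asymptotics of `Z_N(f, r)`. -/
def relError (N : ℕ) (f : ℝ → ℝ) (r : ℝ) : ℝ :=
  rescaledEnergyDensity N f (r ^ 2) / rescaledEnergyDensity N stdGaussian N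
    - gaussianProfile N f (r ^ 2)

theorem Z_eq_mul_gaussianProfile_add_relError (hN : 2 ≤ N) (hf0 : energyDev f ≠ 0) (hr : 0 < r) :
    Z N f r = √2 / energyDev f * gaussRadial N r * (alpha N N / alpha N (r ^ 2)) *
      (gaussianProfile N f (r ^ 2) + relError N f r) := by
  have N_pos : (0 : ℝ) < N := by exact_mod_cast (by lia : 0 < N)
  have := shellDensity_pos (N := N) (by lia) (pow_pos hr 2)
  have := energyDensity_stdGaussian_pos (N := N) (by lia) N_pos
  have : 0 < gaussRadial N r := by
    unfold gaussRadial
    positivity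
  have density_eq : energyDensity N f (r ^ 2) = shellDensity N (r ^ 2) * Z N f r := by
    rw [energyDensity, Real.sqrt_sq hr.le]
  rw [relError, add_sub_cancel, alpha_div_alpha hN N_pos (pow_pos hr 2),
    energyDensity_stdGaussian (by lia) (r ^ 2), rescaledEnergyDensity, rescaledEnergyDensity,
    energyDev_stdGaussian, density_eq, Real.sqrt_sq hr.le]
  field_simp

theorem Z_sqrt_natCast_eq (hN : 2 ≤ N) (hf0 : energyDev f ≠ 0) :
    Z N f √N = √2 / energyDev f * gaussRadial N √N *
      (Real.exp (-(N * (1 - energy f) ^ 2) / (2 * energyDev f ^ 2)) + relError N f √N) := by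
  have N_pos : (0 : ℝ) < N := by exact_mod_cast (by lia : 0 < N)
  have alpha_ne_zero : alpha N N ≠ 0 := by
    unfold alpha
    positivity
  rw [Z_eq_mul_gaussianProfile_add_relError hN hf0 (Real.sqrt_pos.2 N_pos),
    Real.sq_sqrt N_pos.le, div_self alpha_ne_zero, mul_one, gaussianProfile_natCast (by lia)]

theorem abs_div_sub_le {a b x η : ℝ} (hη : η ≤ 1 / 2) (hx0 : 0 ≤ x) (hx1 : x ≤ 1)
    (ha : |a - x| ≤ η) (hb : |b - 1| ≤ η) : |a / b - x| ≤ 4 * η := by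
  have half_le : 1 / 2 ≤ b := by linarith [(abs_le.1 hb).1]
  have b_pos : 0 < b := by linarith
  have div_sub_eq : a / b - x = ((a - x) - x * (b - 1)) / b := by
    field_simp
    ring
  rw [div_sub_eq, abs_div, abs_of_pos b_pos, div_le_iff₀ b_pos]
  calc |(a - x) - x * (b - 1)| ≤ |a - x| + |x * (b - 1)| := abs_sub _ _
    _ ≤ η + 1 * η := by
      rw [abs_mul, abs_of_nonneg hx0]
      gcongr
    _ ≤ 4 * η * b := by nlinarith [abs_nonneg (a - x)]

theorem eventually_abs_relError_le (hp : 1 < p) (hSmin : 0 < Smin)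
    (hχ : Tendsto χ (𝓝[>] 0) (𝓝 0)) {η : ℝ} (hη : 0 < η) :
    ∀ᶠ N : ℕ in atTop, ∀ f, IsAdmissible p Emax Smin L χ f → ∀ r, |relError N f r| ≤ η := by
  have min_pos : 0 < min (1 / 2) (η / 4) := by positivity
  filter_upwards [eventually_abs_rescaledEnergyDensity_sub_le hp hSmin hχ min_pos,
    eventually_abs_rescaledEnergyDensity_stdGaussian_sub_one_le min_pos] with N local_limit
    local_limit_stdGaussian f hf r
  refine (abs_div_sub_le (min_le_left _ _) (gaussianProfile_nonneg N f _)
    (gaussianProfile_le_one N f _) (local_limit f hf _) local_limit_stdGaussian).trans ?_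
  linarith [min_le_right (1 / 2) (η / 4)]

theorem exists_tendsto_zero_and_abs_le {ι : Type*} {a : ℕ → ι → ℝ}
    (ha : ∀ η > 0, ∀ᶠ N in atTop, ∀ i, |a N i| ≤ η) :
    ∃ ω : ℕ → ℝ, Tendsto ω atTop (𝓝 0) ∧ ∀ᶠ N in atTop, ∀ i, |a N i| ≤ ω N := by
  refine ⟨fun N => ⨆ i, |a N i|, Metric.tendsto_nhds.2 fun η hη => ?_, ?_⟩
  · filter_upwards [ha (η / 2) (half_pos hη)] with N hN
    rw [Real.dist_eq, sub_zero, abs_of_nonneg (Real.iSup_nonneg fun i => abs_nonneg _)]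
    exact (Real.iSup_le hN (half_pos hη).le).trans_lt (half_lt_self hη)
  · filter_upwards [ha 1 one_pos] with N hN
    exact le_ciSup ⟨1, Set.forall_mem_range.2 hN⟩

theorem exists_tendsto_zero_and_abs_relError_le (hp : 1 < p) (hSmin : 0 < Smin)
    (hχ : Tendsto χ (𝓝[>] 0) (𝓝 0)) :
    ∃ ω : ℕ → ℝ, Tendsto ω atTop (𝓝 0) ∧ ∀ᶠ N in atTop,
      ∀ f, IsAdmissible p Emax Smin L χ f → ∀ r, |relError N f r| ≤ ω N := by
  obtain ⟨ω, hω, abs_le⟩ := exists_tendsto_zero_and_abs_le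
    (a := fun N (i : {f // IsAdmissible p Emax Smin L χ f} × ℝ) => relError N i.1 i.2)
    fun η hη => (eventually_abs_relError_le hp hSmin hχ hη).mono fun N hN i =>
      hN _ i.1.2 i.2
  exact ⟨ω, hω, abs_le.mono fun N hN f hf r => hN (⟨f, hf⟩, r)⟩

end PartitionFunction

end CondTensor

end

theorem mainTheorem6
    (p : ℝ) (hp : 1 < p) (Emin Emax Smin L : ℝ) (hEmin : 0 < Emin) (hSmin : 0 < Smin)
    (χ : ℝ → ℝ) (hχ_nonneg : ∀ r > 0, 0 ≤ χ r) (hχ_lim : Tendsto χ (𝓝[>] 0) (𝓝 0)) :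
    ∃ (ω : ℕ → ℝ) (N₀ : ℕ), Tendsto ω atTop (𝓝 0) ∧
      ∀ f : ℝ → ℝ, CondTensor.IsProbDensity f →
        Integrable (fun v => f v * v ^ 4) →
        MemLp f (ENNReal.ofReal p) →
        Emin ≤ CondTensor.energy f → CondTensor.energy f ≤ Emax →
        Smin ≤ CondTensor.energyDev f →
        eLpNorm f (ENNReal.ofReal p) volume ≤ ENNReal.ofReal L →
        (∀ r > 0, (∫ v in {v : ℝ | 1 / r ≤ |v|}, f v * v ^ 4) ≤ χ r) →
        ∀ N ≥ N₀,
          (∀ r > 0,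
            -- the integral over the sphere is well defined for the class of `f`
            Integrable (CondTensor.tensorPow f N) (CondTensor.sphereUnif N r) ∧
            (∀ g : ℝ → ℝ, g =ᵐ[volume] f → CondTensor.Z N g r = CondTensor.Z N f r) ∧
            ∃ ε : ℝ, |ε| ≤ ω N ∧
              CondTensor.Z N f r =
                Real.sqrt 2 / CondTensor.energyDev f * CondTensor.gaussRadial N r *
                  (CondTensor.alpha N N / CondTensor.alpha N (r ^ 2)) *
                  (Real.exp (-(r ^ 2 - N * CondTensor.energy f) ^ 2 /
                    (2 * N * CondTensor.energyDev f ^ 2)) + ε)) ∧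
          ∃ ε : ℝ, |ε| ≤ ω N ∧
            CondTensor.Z N f (Real.sqrt N) =
              Real.sqrt 2 / CondTensor.energyDev f * CondTensor.gaussRadial N (Real.sqrt N) *
                (Real.exp (-(N * (1 - CondTensor.energy f) ^ 2) /
                  (2 * CondTensor.energyDev f ^ 2)) + ε) := by
  obtain ⟨ω, hω, relError_le⟩ :=
    CondTensor.exists_tendsto_zero_and_abs_relError_le (p := p) (Emax := Emax) (L := L)
      hp hSmin hχ_lim
  obtain ⟨N₀, hN₀⟩ := eventually_atTop.1 <| (eventually_ge_atTop 3).and <|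
    (CondTensor.eventually_div_sub_two_le hp).and relError_le
  refine ⟨ω, N₀, hω, fun f hf hf4 _ _ hE hdev hL htail N hN => ?_⟩
  obtain ⟨three_le, exponent_le, relError_le⟩ := hN₀ N hN
  have admissible : CondTensor.IsAdmissible p Emax Smin L χ f := ⟨hf, hf4, hE, hdev, hL, htail⟩
  have memLp := admissible.memLp_of_le (CondTensor.one_le_div_sub_two three_le) exponent_le
  have two_le : 2 ≤ N := by lia
  have dev_ne_zero : CondTensor.energyDev f ≠ 0 := (hSmin.trans_le hdev).ne'
  refine ⟨fun r hr => ⟨?_, fun g hg => ?_, CondTensor.relError N f r, ?_, ?_⟩,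
    CondTensor.relError N f √N, ?_, ?_⟩
  · exact CondTensor.integrable_tensorPow three_le rfl hr memLp
  · exact CondTensor.Z_congr_ae three_le hr hg
  · exact relError_le f admissible r
  · exact CondTensor.Z_eq_mul_gaussianProfile_add_relError two_le dev_ne_zero hr
  · exact relError_le f admissible √N
  · exact CondTensor.Z_sqrt_natCast_eq two_le dev_ne_zero
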